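/- Let $p$ be a prime number and let $K$ be an ultrametric extension of $\mathbf{Q}_p$, i.e. an extension field of $\mathbf{Q}_p$ equipped with an absolute value $|\cdot|$ extending the one of $\mathbf{Q}_p$ ($K$ need not be complete). Let $L(T)\in K[T]$, let $P(T)\in K[T]$ be its primitive without constant term ($P'=L$, $P(0)=0$), let $D$ be the degree of $P$ (with $D=0$ if $P=0$), and consider the differential equation $$y'=L(T)\cdot y .\qquad (1)$$ For $1\le n\le D$ put $d_n=\lfloor\log_p(D/n)\rfloor$. Let $d=\lfloor\log_p D\rfloor$ (with $d=0$ if $D=0$), let $\zeta$ be a primitive root of unity of order $p^{d+1}$ in an extension field of $K$, and put $\zeta_{j}=\zeta^{p^{d-j}}$ for $0\le j\le d$, which is a primitive root of unity of order $p^{j+1}$. With $a$ an indeterminate, write $$P(T+a)=P(a)+\sum_{i=1}^{D}a_i(a)\,T^i,\qquad a_i(a)\in K[a],$$ $$\widetilde P(T,a)=\sum_{n=1}^{D}\frac{a_n(a)}{\zeta_{d_n}-1}\,T^n\in K[\zeta][a][T],$$ and let $$\widetilde e(T,a)=1+\sum_{i=1}^{D}\widetilde{a_i}(a)\,T^i,\qquad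 \widetilde{a_i}(a)\in K[\zeta][a],$$ be the polynomial obtained from the power series $\exp(\widetilde P(T,a))\in K[\zeta][a][[T]]$ by keeping only the terms of degree at most $D$ in $T$. Let $a$ now be any element of an ultrametric extension $\Omega$ of $K$ (a field extension with an absolute value extending that of $K$), and let $y=\sum_{n\ge0}b_n(T-a)^n\in\Omega[[T-a]]$ be a nonzero formal solution of (1) at $a$. Let $\rho(a)\in[0,\infty]$ be its radius of convergence, $1/\rho(a)=\limsup_n|b_n|^{1/n}$. Then, for any ultrametric extension of $\Omega$ that also contains $K(\zeta)$, whose absolute value is used to compute $|\widetilde{a_i}(a)|$, $$-\log\rho(a)=\max_{1\le i\le D}\frac1i\,\log\bigl|\widetilde{a_i}(a)\bigr| .$$ Here $\log 0=-\infty$ and $\log\infty=\infty$; if $L=0$ (so $D=0$), the maximum of the empty family is $-\infty$ and $\rho(a)=\infty$. -/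

import Mathlib

open Polynomial

noncomputable section

/-- The polynomial `P(T, a) := P(T + a)` in the indeterminate `T`, with coefficients in `K[a]`
(`a` being a second indeterminate). Its coefficient of `T ^ i`, for `1 ≤ i`, is the polynomial
`a_i(a)`. -/
def translatedPoly {K : Type*} [Field K] (P : K[X]) : K[X][X] :=
  taylor (X : K[X]) (P.map C)

/-- The integer `d_n = ⌊log_p (D / n)⌋`, for `1 ≤ n ≤ D`: the largest `d` with `n * p ^ d ≤ D`. -/
def truncLen (p D n : ℕ) : ℕ := Nat.log p (D / n)

/-- For `ζ` a primitive root of unity of order `p ^ (d + 1)` with `d = d_1 = ⌊log_p D⌋`, this is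
`ζ_{d_n} = ζ ^ (p ^ (d - d_n))`, a primitive root of unity of order `p ^ (d_n + 1)`. -/
def rootAt {E : Type*} [Field E] (p D : ℕ) (ζ : E) (n : ℕ) : E :=
  ζ ^ p ^ (truncLen p D 1 - truncLen p D n)

/-- The polynomial `P̃(T, a) = ∑_{1 ≤ n ≤ D} a_n(a) / (ζ_{d_n} - 1) * T ^ n` in the indeterminate
`T`, with coefficients in `E[a]`, where `D` is the degree of `P`. -/
def tildePoly {K E : Type*} [Field K] [Field E] [Algebra K E] (p : ℕ) (ζ : E) (P : K[X]) :
    E[X][X] :=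
  ∑ n ∈ Finset.Icc 1 P.natDegree,
    C (C (rootAt p P.natDegree ζ n - 1)⁻¹ *
      ((translatedPoly P).coeff n).map (algebraMap K E)) * X ^ n

/-- The polynomial `ẽ(T, a)`: the truncation of the power series `exp (P̃(T, a))` in `E[a]⟦T⟧`,
in which the terms of degree at most `D` in `T` are kept. -/
def tildeExp {K E : Type*} [Field K] [Field E] [CharZero E] [Algebra K E] (p : ℕ) (ζ : E)
    (P : K[X]) : E[X][X] :=
  PowerSeries.trunc (P.natDegree + 1)
    ((PowerSeries.exp E[X]).subst (tildePoly p ζ P : PowerSeries E[X]))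

/-- The polynomial `ã_i(a)` in `E[a]`: the coefficient of `T ^ i` in `ẽ(T, a)`. -/
def tildeCoeff {K E : Type*} [Field K] [Field E] [CharZero E] [Algebra K E] (p : ℕ) (ζ : E)
    (P : K[X]) (i : ℕ) : E[X] :=
  (tildeExp p ζ P).coeff i

/-- The radius of convergence of a power series `∑ b_n T ^ n` over a normed field, by Cauchy's
formula `1 / ρ = limsup |b_n| ^ (1 / n)`, with values in `[0, ∞]`. -/
def convRadius {Ω : Type*} [NormedField Ω] (y : PowerSeries Ω) : ENNReal :=
  (Filter.limsup (fun n : ℕ => ‖PowerSeries.coeff n y‖ₑ ^ (1 / (n : ℝ))) Filter.atTop)⁻¹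

/-- `y(T)`, read as the Taylor expansion at `a` in the local coordinate `T` (which stands for
`T - a`), is a formal solution at `a` of the differential equation `y' = L(T) y`. -/
def IsTaylorSolutionAt {K Ω : Type*} [Field K] [Field Ω] [Algebra K Ω] (L : K[X]) (a : Ω)
    (y : PowerSeries Ω) : Prop :=
  PowerSeries.derivative Ω y = (taylor a (L.map (algebraMap K Ω)) : PowerSeries Ω) * y

end

/-! After translation to `a`, the solution `y` is a nonzero constant times `f = exp Q`, where `Q =
P(T + a) - P(a)`. Let `g = exp Q̃`. With `z_n = ζ_{d_n}`, the `n`-th coefficient of `Q` is `z_n - 1`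
times that of `Q̃`. Exponentials are handled through `X f' / f`, which for the Artin-Hasse series
`E` is `∑ X ^ (p ^ k)`; the coefficients of `E` are integral (`IsExpOf.norm_coeff_le_one`).

Up to degree `D`, `g` is a product of series `E(c_n X ^ n)`, `n ≤ D`, and `|g_i| ≤ r ^ i` for `1 ≤ i
≤ D` forces `|c_n| ≤ r ^ n`. Since `z_n ^ (p ^ k)` is `z_{n p ^ k}` when `n p ^ k ≤ D` and `1`
otherwise, comparing logarithmic derivatives gives the exact identity `f = ∏ B_n(c_n X ^ n)` with
`B_n = E(z_n X) / E(X)` (`IsRootFamily.exists_factorization`). As `B_n` is integral, `|f_m| ≤ r ^ m`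
for all `m` (`IsRootFamily.coeffLE`).

Conversely, let `r > 0` be the maximum of the `|g_i| ^ (1 / i)`. Some `|c_n|` equals `r ^ n`; the
factors with `|c_n| < r ^ n`, and their inverses, grow more slowly and can be divided out. Because
`B_n ≡ 1 + (z_n - 1) ∑ X ^ (p ^ k)` modulo `(z_n - 1) ^ 2`, the remaining product has, for `n₀` its
least index, coefficients of norm at least `|z_{n₀} - 1| r ^ m` in the degrees `m = n₀ p ^ k`
(`IsRootFamily.le_norm_coeff_prod`). Hence no slower growth is possible
(`IsRootFamily.not_coeffLE`). -/

namespace PowerSeries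

/-! ### Exponentials of power series through logarithmic derivatives -/

/-- `f` is the exponential of a power series whose image under `X * d/dX` is `W`. -/
def IsExpOf {R : Type*} [CommRing R] (W f : R⟦X⟧) : Prop :=
  constantCoeff f = 1 ∧ X * d⁄dX R f = W * f

theorem coeff_X_mul_derivative {R : Type*} [CommRing R] (f : R⟦X⟧) (n : ℕ) :
    coeff n (X * d⁄dX R f) = n * coeff n f := by
  cases n with
  | zero => simp
  | succ n => rw [coeff_succ_X_mul, coeff_derivative]; push_cast; ring

namespace IsExpOf

section CommRing

variable {R : Type*} [CommRing R]

theorem one : IsExpOf (0 : R⟦X⟧) 1 := by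
  constructor <;> simp

theorem mul {W W' f f' : R⟦X⟧} (h : IsExpOf W f) (h' : IsExpOf W' f') :
    IsExpOf (W + W') (f * f') := by
  refine ⟨by simp [h.1, h'.1], ?_⟩
  rw [Derivation.leibniz, smul_eq_mul, smul_eq_mul]
  linear_combination f' * h.2 + f * h'.2

theorem prod {ι : Type*} (s : Finset ι) {W f : ι → R⟦X⟧} (h : ∀ i ∈ s, IsExpOf (W i) (f i)) :
    IsExpOf (∑ i ∈ s, W i) (∏ i ∈ s, f i) := by
  classical
  induction s using Finset.induction_on with
  | empty => simpa using one
  | insert a s ha ih =>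
    rw [Finset.sum_insert ha, Finset.prod_insert ha]
    exact (h a (Finset.mem_insert_self a s)).mul
      (ih fun i hi => h i (Finset.mem_insert_of_mem hi))

theorem pow {W f : R⟦X⟧} (h : IsExpOf W f) (n : ℕ) : IsExpOf ((n : R⟦X⟧) * W) (f ^ n) := by
  simpa using prod (Finset.range n) (W := fun _ => W) (f := fun _ => f) fun _ _ => h

theorem of_mul_right {W W' f f' : R⟦X⟧} (h : IsExpOf W f) (h' : IsExpOf W' (f * f')) :
    IsExpOf (W' - W) f' := by
  have hc : constantCoeff f' = 1 := by simpa [h.1] using h'.1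
  have hu : IsUnit f := by rw [isUnit_iff_constantCoeff, h.1]; exact isUnit_one
  refine ⟨hc, hu.mul_left_cancel ?_⟩
  have h2 := h'.2
  rw [Derivation.leibniz, smul_eq_mul, smul_eq_mul] at h2
  linear_combination h2 - f' * h.2

theorem rescale {W f : R⟦X⟧} (h : IsExpOf W f) (a : R) :
    IsExpOf (PowerSeries.rescale a W) (PowerSeries.rescale a f) := by
  refine ⟨by simp [← coeff_zero_eq_constantCoeff_apply, coeff_rescale, h.1], ?_⟩
  rw [← map_mul, ← h.2]
  ext n
  simp only [coeff_X_mul_derivative, coeff_rescale]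
  ring

theorem expand {W f : R⟦X⟧} (h : IsExpOf W f) {n : ℕ} (hn : n ≠ 0) :
    IsExpOf ((n : R⟦X⟧) * PowerSeries.expand n hn W) (PowerSeries.expand n hn f) := by
  refine ⟨by simp [h.1], ?_⟩
  rw [mul_assoc, ← map_mul, ← h.2]
  ext m
  rw [← map_natCast C, coeff_C_mul]
  simp only [coeff_X_mul_derivative, coeff_expand]
  split_ifs with hm
  · obtain ⟨k, rfl⟩ := hm
    rw [Nat.mul_div_cancel_left _ (Nat.pos_of_ne_zero hn)]
    push_cast; ring
  · simp

theorem map {S : Type*} [CommRing S] {W f : R⟦X⟧} (h : IsExpOf W f) (φ : R →+* S) :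
    IsExpOf (PowerSeries.map φ W) (PowerSeries.map φ f) := by
  refine ⟨?_, ?_⟩
  · rw [← coeff_zero_eq_constantCoeff_apply, coeff_map, coeff_zero_eq_constantCoeff_apply, h.1,
      map_one]
  rw [← map_mul, ← h.2]
  ext n
  rw [coeff_map, coeff_X_mul_derivative, coeff_X_mul_derivative, coeff_map, map_mul, map_natCast]

theorem exp_subst [Algebra ℚ R] {Q : R⟦X⟧} (hQ : constantCoeff Q = 0) :
    IsExpOf (X * d⁄dX R Q) ((exp R).subst Q) := by
  have hs : HasSubst Q := HasSubst.of_constantCoeff_zero' hQ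
  refine ⟨?_, ?_⟩
  · have h1 := constantCoeff_subst_eq_zero hQ (exp R - 1) (by simp)
    rw [subst_sub hs] at h1
    have h2 : (1 : R⟦X⟧).subst Q = (1 : R⟦X⟧) := by
      rw [← coe_substAlgHom hs, map_one]
    rw [h2] at h1
    have h3 : constantCoeff ((exp R).subst Q - 1) = 0 := h1
    simpa [sub_eq_zero] using h3
  · rw [derivative_subst hs, derivative_exp]
    ring

/-- `W` has no constant term, so `n * f_n` depends only on `W` up to degree `n` and on earlier
coefficients of `f`; torsion-freeness cancels `n`. -/
theorem coeff_congr [IsAddTorsionFree R] [NoZeroDivisors R] {W W' f f' : R⟦X⟧} (h : IsExpOf W f)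
    (h' : IsExpOf W' f') {N : ℕ} (hW : ∀ n ≤ N, coeff n W = coeff n W') :
    ∀ n ≤ N, coeff n f = coeff n f' := by
  have h0 : ∀ {W f : R⟦X⟧}, IsExpOf W f → coeff 0 W = 0 := by
    intro W f h
    have := congrArg (coeff 0) h.2
    simpa [h.1] using this.symm
  intro n
  induction n using Nat.strong_induction_on with
  | _ n ih =>
    intro hn
    rcases Nat.eq_zero_or_pos n with rfl | hpos
    · simp [h.1, h'.1]
    have e : coeff n (W * f) = coeff n (W' * f') := by
      rw [coeff_mul, coeff_mul]
      refine Finset.sum_congr rfl fun x hx => ?_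
      rw [Finset.HasAntidiagonal.mem_antidiagonal] at hx
      rcases Nat.eq_zero_or_pos x.1 with h1 | h1
      · rw [h1, h0 h, h0 h']; simp
      · rw [hW _ (by omega), ih _ (by omega) (by omega)]
    rw [← h.2, ← h'.2, coeff_X_mul_derivative, coeff_X_mul_derivative] at e
    rw [← nsmul_eq_mul, ← nsmul_eq_mul] at e
    exact nsmul_right_injective hpos.ne' e

theorem unique [IsAddTorsionFree R] [NoZeroDivisors R] {W f f' : R⟦X⟧} (h : IsExpOf W f)
    (h' : IsExpOf W f') : f = f' := by
  ext n
  exact h.coeff_congr h' (N := n) (fun _ _ => rfl) n le_rfl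

/-- As `f` has constant term `1`, `W = X f' / f` is computed recursively without dividing by
integers. -/
theorem coeff_logDeriv_congr {W W' f f' : R⟦X⟧} (h : IsExpOf W f)
    (h' : IsExpOf W' f') {N : ℕ} (hf : ∀ n ≤ N, coeff n f = coeff n f') :
    ∀ n ≤ N, coeff n W = coeff n W' := by
  intro n
  induction n using Nat.strong_induction_on with
  | _ n ih =>
    intro hn
    have e : coeff n (W * f) = coeff n (W' * f') := by
      rw [← h.2, ← h'.2, coeff_X_mul_derivative, coeff_X_mul_derivative, hf n hn]
    have key : ∀ W f : R⟦X⟧, constantCoeff f = 1 → coeff n (W * f) =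
        coeff n W + ∑ x ∈ (Finset.HasAntidiagonal.antidiagonal n).erase (n, 0),
          coeff x.1 W * coeff x.2 f := by
      intro W f hf
      rw [coeff_mul, ← Finset.add_sum_erase _ _ (a := (n, 0)) (by simp)]
      simp [hf]
    rw [key W f h.1, key W' f' h'.1] at e
    have : ∑ x ∈ (Finset.HasAntidiagonal.antidiagonal n).erase (n, 0), coeff x.1 W * coeff x.2 f =
        ∑ x ∈ (Finset.HasAntidiagonal.antidiagonal n).erase (n, 0), coeff x.1 W' * coeff x.2 f' := by
      refine Finset.sum_congr rfl fun x hx => ?_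
      rw [Finset.mem_erase, Finset.HasAntidiagonal.mem_antidiagonal, Ne, Prod.ext_iff] at hx
      dsimp only at hx
      rw [ih x.1 (by omega) (by omega), hf x.2 (by omega)]
    rw [this] at e
    exact add_right_cancel e

end CommRing

end IsExpOf

theorem exists_isExpOf {F : Type*} [Field F] [CharZero F] {W : F⟦X⟧} (hW : constantCoeff W = 0) :
    ∃ f, IsExpOf W f := by
  -- In degree `0` the division by zero yields `0`, as the substitution requires.
  have h := IsExpOf.exp_subst (Q := mk fun n => coeff n W / (n : F)) (by
    rw [← coeff_zero_eq_constantCoeff_apply, coeff_mk]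
    simp)
  have e : X * d⁄dX F (mk fun n => coeff n W / (n : F)) = W := by
    ext n
    rw [coeff_X_mul_derivative, coeff_mk]
    rcases eq_or_ne n 0 with rfl | hn
    · simpa using hW.symm
    · field_simp
  rw [e] at h
  exact ⟨_, h⟩

/-! ### The series `∑ X ^ (p ^ k)` -/

open Classical in
/-- The power series `∑ X ^ (p ^ k)`. -/
noncomputable def frobSum (R : Type*) [CommRing R] (p : ℕ) : R⟦X⟧ :=
  mk fun n => if ∃ k, n = p ^ k then 1 else 0

open Classical in
theorem coeff_frobSum (R : Type*) [CommRing R] (p n : ℕ) :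
    coeff n (frobSum R p) = if ∃ k, n = p ^ k then 1 else 0 := by
  simp [frobSum]

theorem map_frobSum {R S : Type*} [CommRing R] [CommRing S] (p : ℕ) (φ : R →+* S) :
    map φ (frobSum R p) = frobSum S p := by
  ext n
  simp only [coeff_map, coeff_frobSum]
  split_ifs <;> simp

theorem expand_frobSum_add_X (R : Type*) [CommRing R] {p : ℕ} (hp : p.Prime) :
    expand p hp.ne_zero (frobSum R p) + X = frobSum R p := by
  ext n
  simp only [map_add, coeff_expand, coeff_frobSum, coeff_X]
  have hp1 := hp.one_lt
  by_cases h1 : n = 1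
  · subst h1
    rw [if_neg (by simpa using hp.one_lt.ne'), if_pos rfl, if_pos ⟨0, by simp⟩, zero_add]
  · rw [if_neg h1, add_zero]
    by_cases hd : p ∣ n
    · obtain ⟨m, rfl⟩ := hd
      rw [if_pos (dvd_mul_right p m), Nat.mul_div_cancel_left _ hp.pos]
      congr 1
      apply propext
      constructor
      · rintro ⟨k, rfl⟩
        exact ⟨k + 1, by ring⟩
      · rintro ⟨k, hk⟩
        cases k with
        | zero => exact absurd hk h1
        | succ k =>
          exact ⟨k, Nat.eq_of_mul_eq_mul_left hp.pos (by rw [hk]; ring)⟩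
    · rw [if_neg hd, if_neg]
      rintro ⟨k, rfl⟩
      cases k with
      | zero => exact h1 rfl
      | succ k => exact hd (dvd_pow_self p (Nat.succ_ne_zero k))

end PowerSeries

/-! ### Integrality of the Artin-Hasse exponential -/

theorem PadicInt.norm_coeff_pow_sub_expand_le (p : ℕ) [Fact p.Prime] (h : ℤ_[p][X]) (n : ℕ) :
    ‖(h ^ p - expand ℤ_[p] p h).coeff n‖ ≤ (p : ℝ)⁻¹ := by
  have h0 : (h ^ p - expand ℤ_[p] p h).map PadicInt.toZMod = 0 := by
    rw [Polynomial.map_sub, Polynomial.map_pow, Polynomial.map_expand, ZMod.expand_card, sub_self]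
  have h1 : PadicInt.toZMod ((h ^ p - expand ℤ_[p] p h).coeff n) = 0 := by
    rw [← Polynomial.coeff_map, h0, Polynomial.coeff_zero]
  rw [← RingHom.mem_ker, PadicInt.ker_toZMod, PadicInt.maximalIdeal_eq_span_p] at h1
  have := (PadicInt.norm_le_pow_iff_mem_span_pow _ 1).2 (by simpa using h1)
  simpa using this

namespace PowerSeries

/-- The valuation of `n!` is less than `n`, so `p ^ n / n!` is divisible by `p`. -/
theorem norm_coeff_rescale_exp_le (p : ℕ) [Fact p.Prime] {n : ℕ} (hn : n ≠ 0) :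
    ‖coeff n (rescale (p : ℚ_[p]) (exp ℚ_[p]))‖ ≤ (p : ℝ)⁻¹ := by
  have hp : 1 < (p : ℝ) := by exact_mod_cast (Fact.out : p.Prime).one_lt
  have hv := padicValNat_factorial_lt_of_ne_zero p hn
  have hf : ‖((n.factorial : ℕ) : ℚ_[p])‖ = (p : ℝ) ^ (-(padicValNat p n.factorial : ℤ)) := by
    rw [Padic.norm_eq_zpow_neg_valuation (by exact_mod_cast n.factorial_ne_zero),
      Padic.valuation_natCast]
  rw [coeff_rescale, coeff_exp, norm_mul, norm_pow, Padic.norm_p, map_div₀, map_one, map_natCast,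
    norm_div, norm_one, hf, one_div, ← zpow_neg, neg_neg, inv_pow, ← zpow_natCast, ← zpow_neg,
    ← zpow_add₀ (by positivity), ← zpow_neg_one]
  exact zpow_le_zpow_right₀ hp.le (by omega)

/-- Write `f` as its truncation plus `X ^ n * u`; the difference of the `k`-th powers is `X ^ n * u`
times a sum of `k` series with constant term `1`. -/
theorem coeff_pow_eq_add_of_trunc {R : Type*} [CommRing R] {f : R⟦X⟧} (hf : constantCoeff f = 1)
    {n : ℕ} (hn : 0 < n) (k : ℕ) :
    coeff n (f ^ k) = coeff n ((trunc n f : R⟦X⟧) ^ k) + k * coeff n f := by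
  have hd : (X : R⟦X⟧) ^ n ∣ f - (trunc n f : R⟦X⟧) := by
    rw [X_pow_dvd_iff]
    intro m hm
    simp [coeff_trunc, hm]
  obtain ⟨u, hu⟩ := hd
  have hu0 : constantCoeff u = coeff n f := by
    have := congrArg (coeff n) hu
    rw [coeff_X_pow_mul', if_pos le_rfl, Nat.sub_self, map_sub, Polynomial.coeff_coe,
      coeff_trunc, if_neg (lt_irrefl n), sub_zero] at this
    rw [← coeff_zero_eq_constantCoeff_apply]
    exact this.symm
  have ht : constantCoeff (trunc n f : R⟦X⟧) = 1 := by
    rw [← coeff_zero_eq_constantCoeff_apply, Polynomial.coeff_coe, coeff_trunc, if_pos hn,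
      coeff_zero_eq_constantCoeff_apply, hf]
  rw [← sub_eq_iff_eq_add', ← map_sub, ← (Commute.all _ _).mul_geom_sum₂, hu, mul_assoc,
    coeff_X_pow_mul',
    if_pos le_rfl, Nat.sub_self, coeff_zero_eq_constantCoeff_apply, map_mul, hu0]
  simp [hf, ht, mul_comm]

/-- Both sides have logarithmic derivative `p * ∑ X ^ (p ^ k)`, since `X ↦ X ^ p` removes just the
term `X` from the sum. -/
theorem IsExpOf.pow_eq_expand_mul (p : ℕ) [hp : Fact p.Prime] {f : ℚ_[p]⟦X⟧}
    (hf : IsExpOf (frobSum ℚ_[p] p) f) :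
    f ^ p = PowerSeries.expand p hp.out.ne_zero f * PowerSeries.rescale (p : ℚ_[p]) (exp ℚ_[p]) := by
  have he : IsExpOf (X : ℚ_[p]⟦X⟧) (exp ℚ_[p]) :=
    ⟨constantCoeff_exp, by rw [derivative_exp]⟩
  refine (hf.pow p).unique ?_
  convert (hf.expand hp.out.ne_zero).mul (he.rescale (p : ℚ_[p])) using 1
  rw [rescale_X, map_natCast, ← mul_add, expand_frobSum_add_X _ hp.out]

/-- Integrality of the coefficients of the Artin-Hasse exponential. -/
theorem IsExpOf.norm_coeff_le_one (p : ℕ) [hp : Fact p.Prime] {f : ℚ_[p]⟦X⟧}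
    (hf : IsExpOf (frobSum ℚ_[p] p) f) (n : ℕ) : ‖coeff n f‖ ≤ 1 := by
  induction n using Nat.strong_induction_on with
  | _ n ih =>
    rcases Nat.eq_zero_or_pos n with rfl | hn
    · simp [hf.1]
    have hp0 : (0 : ℝ) < p := by exact_mod_cast hp.out.pos
    obtain ⟨h, hh⟩ : ∃ h : ℤ_[p][X], h.map PadicInt.Coe.ringHom = trunc n f := by
      have : (trunc n f) ∈ Polynomial.lifts (PadicInt.Coe.ringHom (p := p)) := by
        rw [Polynomial.lifts_iff_coeff_lifts]
        intro m
        rw [coeff_trunc]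
        split_ifs with hm
        · exact ⟨⟨coeff m f, ih m hm⟩, rfl⟩
        · exact ⟨0, map_zero _⟩
      exact (Polynomial.mem_lifts _).1 this
    -- In degree `n` of `f ^ p = f(X ^ p) exp(p X)`, isolate `p * f_n`. What remains is divisible by
    -- `p`, by Frobenius modulo `p` on the truncation and by the divisibility of the coefficients of
    -- `exp(p X)`.
    have h1 := coeff_pow_eq_add_of_trunc hf.1 hn p
    rw [hf.pow_eq_expand_mul p, coeff_mul,
      ← Finset.add_sum_erase _ _ (a := (n, 0)) (by simp)] at h1
    have h2 : coeff n (PowerSeries.expand p hp.out.ne_zero f) =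
        (Polynomial.expand ℚ_[p] p (trunc n f)).coeff n := by
      rw [coeff_expand, Polynomial.coeff_expand hp.out.pos]
      split_ifs with hd
      · rw [coeff_trunc, if_pos (Nat.div_lt_self hn hp.out.one_lt)]
      · rfl
    have h3 : ‖((trunc n f) ^ p - Polynomial.expand ℚ_[p] p (trunc n f)).coeff n‖ ≤ (p : ℝ)⁻¹ := by
      have := PadicInt.norm_coeff_pow_sub_expand_le p h n
      rw [← hh, ← Polynomial.map_pow, ← Polynomial.map_expand, ← Polynomial.map_sub,
        Polynomial.coeff_map]
      exact this
    have h4 : ‖∑ x ∈ (Finset.HasAntidiagonal.antidiagonal n).erase (n, 0),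
        coeff x.1 (PowerSeries.expand p hp.out.ne_zero f) *
          coeff x.2 (PowerSeries.rescale (p : ℚ_[p]) (exp ℚ_[p]))‖ ≤ (p : ℝ)⁻¹ := by
      refine IsUltrametricDist.norm_sum_le_of_forall_le_of_nonneg (by positivity) fun x hx => ?_
      rw [Finset.mem_erase, Finset.HasAntidiagonal.mem_antidiagonal, Ne, Prod.ext_iff] at hx
      dsimp only at hx
      have hx1 : ‖coeff x.1 (PowerSeries.expand p hp.out.ne_zero f)‖ ≤ 1 := by
        rw [coeff_expand]
        split_ifs
        · exact ih _ ((Nat.div_le_self _ _).trans_lt (by omega))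
        · simp
      rw [norm_mul]
      calc _ ≤ 1 * (p : ℝ)⁻¹ := mul_le_mul hx1 (norm_coeff_rescale_exp_le p (by omega))
              (norm_nonneg _) zero_le_one
        _ = _ := one_mul _
    have h5 : (p : ℚ_[p]) * coeff n f =
        (∑ x ∈ (Finset.HasAntidiagonal.antidiagonal n).erase (n, 0),
          coeff x.1 (PowerSeries.expand p hp.out.ne_zero f) *
            coeff x.2 (PowerSeries.rescale (p : ℚ_[p]) (exp ℚ_[p]))) -
        ((trunc n f) ^ p - Polynomial.expand ℚ_[p] p (trunc n f)).coeff n := by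
      rw [← Polynomial.coe_pow, Polynomial.coeff_coe] at h1
      rw [Polynomial.coeff_sub, ← h2]
      simp only [coeff_rescale, pow_zero, coeff_exp] at h1 ⊢
      simp at h1 ⊢
      linear_combination -h1
    have h6 : ‖(p : ℚ_[p]) * coeff n f‖ ≤ (p : ℝ)⁻¹ := by
      rw [h5]
      rw [sub_eq_add_neg]
      exact (IsUltrametricDist.norm_add_le_max _ _).trans (max_le h4 (by rwa [norm_neg]))
    rw [norm_mul, Padic.norm_p] at h6
    have := mul_le_mul_of_nonneg_left h6 hp0.le
    rwa [← mul_assoc, mul_inv_cancel₀ hp0.ne', one_mul] at this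

end PowerSeries

/-! ### Geometric coefficient bounds and the substitution `X ↦ c X ^ n` -/

namespace PowerSeries

section NormedField

variable {M : Type*} [NormedField M]

/-- The `n`-th coefficient of `f` has norm at most `C * r ^ n`, for all `n`. -/
def CoeffLE (C r : ℝ) (f : M⟦X⟧) : Prop :=
  ∀ n, ‖coeff n f‖ ≤ C * r ^ n

namespace CoeffLE

variable {C C' r : ℝ} {f g : M⟦X⟧}

theorem mono (hf : CoeffLE C r f) (hr : 0 ≤ r) (h : C ≤ C') : CoeffLE C' r f := fun n =>
  (hf n).trans (mul_le_mul_of_nonneg_right h (pow_nonneg hr n))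

theorem mono_radius {r' : ℝ} (hf : CoeffLE C r f) (hC : 0 ≤ C) (hr : 0 ≤ r) (h : r ≤ r') :
    CoeffLE C r' f := fun n =>
  (hf n).trans (mul_le_mul_of_nonneg_left (pow_le_pow_left₀ hr h n) hC)

theorem nonneg (hf : CoeffLE C r f) : 0 ≤ C := by
  simpa using (norm_nonneg _).trans (hf 0)

theorem one (hr : 0 ≤ r) : CoeffLE 1 r (1 : M⟦X⟧) := fun n => by
  rw [coeff_one, one_mul]
  split_ifs with h
  · simp [h]
  · simpa using pow_nonneg hr n

section Ultrametric

variable [IsUltrametricDist M]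

theorem add (hf : CoeffLE C r f) (hg : CoeffLE C r g) : CoeffLE C r (f + g) := fun n => by
  rw [map_add]
  exact (IsUltrametricDist.norm_add_le_max _ _).trans (max_le (hf n) (hg n))

theorem sum {ι : Type*} {s : Finset ι} {f : ι → M⟦X⟧} (hC : 0 ≤ C) (hr : 0 ≤ r)
    (hf : ∀ i ∈ s, CoeffLE C r (f i)) : CoeffLE C r (∑ i ∈ s, f i) := fun n => by
  rw [map_sum]
  exact IsUltrametricDist.norm_sum_le_of_forall_le_of_nonneg
    (mul_nonneg hC (pow_nonneg hr n)) fun i hi => hf i hi n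

theorem mul (hf : CoeffLE C r f) (hg : CoeffLE C' r g) (hr : 0 ≤ r) :
    CoeffLE (C * C') r (f * g) := fun n => by
  have hC := hf.nonneg
  have hC' := hg.nonneg
  rw [coeff_mul]
  refine IsUltrametricDist.norm_sum_le_of_forall_le_of_nonneg (by positivity) fun x hx => ?_
  rw [Finset.HasAntidiagonal.mem_antidiagonal] at hx
  rw [norm_mul, ← hx]
  calc _ ≤ (C * r ^ x.1) * (C' * r ^ x.2) :=
        mul_le_mul (hf _) (hg _) (norm_nonneg _) (by positivity)
    _ = _ := by ring

theorem prod {ι : Type*} {s : Finset ι} {f : ι → M⟦X⟧} (hr : 0 ≤ r)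
    (hf : ∀ i ∈ s, CoeffLE 1 r (f i)) : CoeffLE 1 r (∏ i ∈ s, f i) := by
  classical
  induction s using Finset.induction_on with
  | empty => simpa using one hr
  | insert a s ha ih =>
    rw [Finset.prod_insert ha]
    simpa using (hf a (Finset.mem_insert_self a s)).mul
      (ih fun i hi => hf i (Finset.mem_insert_of_mem hi)) hr

theorem inv (hf : CoeffLE 1 r f) (hr : 0 ≤ r) (h1 : constantCoeff f = 1) : CoeffLE 1 r f⁻¹ := by
  intro n
  induction n using Nat.strong_induction_on with
  | _ n ih =>
    rw [coeff_inv, h1, inv_one]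
    split_ifs with h
    · simp [h]
    rw [norm_mul, norm_neg, norm_one, one_mul]
    refine IsUltrametricDist.norm_sum_le_of_forall_le_of_nonneg (by positivity) fun x hx => ?_
    rw [Finset.HasAntidiagonal.mem_antidiagonal] at hx
    split_ifs with h2
    · rw [norm_mul, ← hx, one_mul, pow_add]
      have h3 := hf x.1
      have h4 := ih x.2 h2
      rw [one_mul] at h3 h4
      exact mul_le_mul h3 h4 (norm_nonneg _) (pow_nonneg hr _)
    · simpa using pow_nonneg hr n

/-- Expanding `∏ (1 + u_i)`, the terms beyond `1 + ∑ u_i` are products of at least two `u_i`, hence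
bounded by `e ^ 2` because `e ≤ 1`. -/
theorem prod_sub_one_sub_sum {ι : Type*} {s : Finset ι} {f : ι → M⟦X⟧} {e : ℝ} (hr : 0 ≤ r)
    (he : 0 ≤ e) (he1 : e ≤ 1) (hf : ∀ i ∈ s, CoeffLE e r (f i - 1)) :
    CoeffLE e r (∏ i ∈ s, f i - 1) ∧
      CoeffLE (e ^ 2) r (∏ i ∈ s, f i - 1 - ∑ i ∈ s, (f i - 1)) := by
  classical
  have h0 : ∀ c : ℝ, 0 ≤ c → CoeffLE c r (0 : M⟦X⟧) := fun c hc n => by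
    rw [map_zero, norm_zero]; positivity
  induction s using Finset.induction_on with
  | empty => simpa using ⟨h0 e he, h0 (e ^ 2) (by positivity)⟩
  | insert a s ha ih =>
    obtain ⟨ih1, ih2⟩ := ih fun i hi => hf i (Finset.mem_insert_of_mem hi)
    have hfa := hf a (Finset.mem_insert_self a s)
    have hm := hfa.mul ih1 hr
    rw [← pow_two] at hm
    rw [Finset.prod_insert ha, Finset.sum_insert ha]
    constructor
    · have e1 : f a * ∏ i ∈ s, f i - 1 =
          (f a - 1) * (∏ i ∈ s, f i - 1) + ((f a - 1) + (∏ i ∈ s, f i - 1)) := by ring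
      rw [e1]
      exact (hm.mono hr (by nlinarith)).add (hfa.add ih1)
    · have e1 : f a * ∏ i ∈ s, f i - 1 - (f a - 1 + ∑ i ∈ s, (f i - 1)) =
          (f a - 1) * (∏ i ∈ s, f i - 1) + (∏ i ∈ s, f i - 1 - ∑ i ∈ s, (f i - 1)) := by ring
      rw [e1]
      exact hm.add ih2

end Ultrametric

end CoeffLE

end NormedField

section ScaledExpand

/-- The power series `f(c * X ^ n)`, for `n ≠ 0`. -/
noncomputable def scaledExpand {R : Type*} [CommRing R] (n : ℕ) (c : R) (f : R⟦X⟧) : R⟦X⟧ :=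
  mk fun m => if n ∣ m then c ^ (m / n) * coeff (m / n) f else 0

theorem coeff_scaledExpand {R : Type*} [CommRing R] (n : ℕ) (c : R) (f : R⟦X⟧) (m : ℕ) :
    coeff m (scaledExpand n c f) = if n ∣ m then c ^ (m / n) * coeff (m / n) f else 0 := by
  rw [scaledExpand, coeff_mk]

theorem scaledExpand_eq {R : Type*} [CommRing R] {n : ℕ} (hn : n ≠ 0) (c : R) (f : R⟦X⟧) :
    scaledExpand n c f = expand n hn (rescale c f) := by
  ext m
  rw [coeff_scaledExpand, coeff_expand, coeff_rescale]

theorem IsExpOf.scaledExpand {R : Type*} [CommRing R] {n : ℕ} (hn : n ≠ 0) (c : R) {W f : R⟦X⟧}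
    (h : IsExpOf W f) :
    IsExpOf ((n : R⟦X⟧) * PowerSeries.scaledExpand n c W) (PowerSeries.scaledExpand n c f) := by
  rw [scaledExpand_eq hn, scaledExpand_eq hn]
  exact (h.rescale c).expand hn

theorem CoeffLE.scaledExpand {M : Type*} [NormedField M] {C r : ℝ} {f : M⟦X⟧} {c : M} {n : ℕ}
    (hf : CoeffLE C 1 f) (hr : 0 ≤ r) (hc : ‖c‖ ≤ r ^ n) :
    CoeffLE C r (PowerSeries.scaledExpand n c f) := fun m => by
  have hC := hf.nonneg
  rw [coeff_scaledExpand]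
  split_ifs with h
  · obtain ⟨k, rfl⟩ := h
    rcases Nat.eq_zero_or_pos n with rfl | hn
    · simpa using hf 0
    rw [Nat.mul_div_cancel_left _ hn, norm_mul, norm_pow, mul_comm, pow_mul]
    have := hf k
    rw [one_pow, mul_one] at this
    exact mul_le_mul this (pow_le_pow_left₀ (norm_nonneg _) hc k) (by positivity) hC
  · rw [norm_zero]; positivity

end ScaledExpand

theorem exists_artinHasse (p : ℕ) [hp : Fact p.Prime] (M : Type*) [NormedField M]
    [NormedAlgebra ℚ_[p] M] :
    ∃ E : M⟦X⟧, IsExpOf (frobSum M p) E ∧ CoeffLE 1 1 E := by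
  obtain ⟨E, hE⟩ := exists_isExpOf (W := frobSum ℚ_[p] p) (by
    rw [← coeff_zero_eq_constantCoeff_apply, coeff_frobSum, if_neg]
    rintro ⟨k, hk⟩
    exact (pow_pos hp.out.pos k).ne hk)
  refine ⟨map (algebraMap ℚ_[p] M) E, ?_, fun n => ?_⟩
  · have := hE.map (algebraMap ℚ_[p] M)
    rwa [map_frobSum] at this
  · rw [coeff_map, norm_algebraMap', one_pow, mul_one]
    exact hE.norm_coeff_le_one p n

end PowerSeries

/-! ### Elements close to `1` in an ultrametric field -/

section Norm

variable {M : Type*} [NormedField M] [IsUltrametricDist M]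

theorem norm_pow_sub_one_le {z : M} (hz : ‖z‖ ≤ 1) (k : ℕ) : ‖z ^ k - 1‖ ≤ ‖z - 1‖ := by
  rw [← mul_geom_sum, norm_mul]
  refine mul_le_of_le_one_right (norm_nonneg _) ?_
  refine IsUltrametricDist.norm_sum_le_of_forall_le_of_nonneg zero_le_one fun i _ => ?_
  rw [norm_pow]
  exact pow_le_one₀ (norm_nonneg _) hz

theorem norm_pow_sub_one_sub_le {z : M} (hz : ‖z‖ ≤ 1) (k : ℕ) :
    ‖z ^ k - 1 - (z - 1) * k‖ ≤ ‖z - 1‖ ^ 2 := by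
  have : z ^ k - 1 - (z - 1) * k = (z - 1) * ∑ i ∈ Finset.range k, (z ^ i - 1) := by
    rw [← mul_geom_sum, Finset.sum_sub_distrib]
    simp; ring
  rw [this, norm_mul, pow_two]
  refine mul_le_mul_of_nonneg_left ?_ (norm_nonneg _)
  exact IsUltrametricDist.norm_sum_le_of_forall_le_of_nonneg (norm_nonneg _) fun i _ =>
    norm_pow_sub_one_le hz i

/-- The quotient `(z ^ k - 1) / (z - 1)` is `k + ∑ (z ^ i - 1)`, and both parts have norm less than
`1`. -/
theorem norm_pow_sub_one_lt {z : M} (hz1 : z ≠ 1) (hz : ‖z - 1‖ < 1) {k : ℕ}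
    (hk : ‖(k : M)‖ < 1) : ‖z ^ k - 1‖ < ‖z - 1‖ := by
  have h0 : 0 < ‖z - 1‖ := norm_pos_iff.2 (sub_ne_zero.2 hz1)
  have hz' : ‖z‖ ≤ 1 := by
    have := IsUltrametricDist.norm_add_le_max (z - 1) 1
    rw [sub_add_cancel, norm_one] at this
    exact this.trans (max_le hz.le le_rfl)
  have e : z ^ k - 1 = (z - 1) * (k + ∑ i ∈ Finset.range k, (z ^ i - 1)) := by
    rw [← mul_geom_sum, Finset.sum_sub_distrib]
    simp
  rw [e, norm_mul]
  refine mul_lt_of_lt_one_right h0 ((IsUltrametricDist.norm_add_le_max _ _).trans_lt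
    (max_lt hk (lt_of_le_of_lt ?_ hz)))
  exact IsUltrametricDist.norm_sum_le_of_forall_le_of_nonneg (norm_nonneg _) fun i _ =>
    norm_pow_sub_one_le hz' i

/-- Frobenius in the residue field: `(z - 1) ^ p` differs from `z ^ p - 1` by a multiple of `p`. -/
theorem norm_sub_one_lt_one_of_pow_prime {p : ℕ} (hp : p.Prime) (hpM : ‖(p : M)‖ < 1)
    {z : M} (hz1 : ‖z‖ ≤ 1) (hz : ‖z ^ p - 1‖ < 1) : ‖z - 1‖ < 1 := by
  have hx : ‖z - 1‖ ≤ 1 := by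
    rw [sub_eq_add_neg]
    exact (IsUltrametricDist.norm_add_le_max _ _).trans (by simpa using hz1)
  have e := add_pow_prime_eq' hp (z - 1) 1
  rw [sub_add_cancel, one_pow] at e
  have e2 : (z - 1) ^ p = (z ^ p - 1) + -(p * ∑ k ∈ Finset.Ioo 0 p,
      (z - 1) ^ k * 1 ^ (p - k) * ((p.choose k / p : ℕ) : M)) := by linear_combination -e
  have h : ‖(z - 1) ^ p‖ < 1 := by
    rw [e2]
    refine (IsUltrametricDist.norm_add_le_max _ _).trans_lt (max_lt hz ?_)
    rw [norm_neg, norm_mul]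
    refine (mul_le_of_le_one_right (norm_nonneg _) ?_).trans_lt hpM
    refine IsUltrametricDist.norm_sum_le_of_forall_le_of_nonneg zero_le_one fun i _ => ?_
    rw [one_pow, mul_one, norm_mul, norm_pow]
    exact mul_le_one₀ (pow_le_one₀ (norm_nonneg _) hx) (norm_nonneg _)
      (IsUltrametricDist.norm_natCast_le_one M _)
  rw [norm_pow] at h
  by_contra hc
  exact absurd h (not_lt.2 (one_le_pow₀ (not_lt.1 hc)))

theorem norm_sub_one_lt_one_of_pow_prime_pow_eq_one {p : ℕ} (hp : p.Prime) (hpM : ‖(p : M)‖ < 1)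
    {k : ℕ} {z : M} (hz : z ^ p ^ k = 1) : ‖z - 1‖ < 1 := by
  induction k generalizing z with
  | zero => simp_all
  | succ k ih =>
    have hz1 : ‖z‖ = 1 := by
      have : ‖z‖ ^ p ^ (k + 1) = 1 := by rw [← norm_pow, hz, norm_one]
      exact (pow_eq_one_iff_of_nonneg (norm_nonneg _) (pow_pos hp.pos _).ne').1 this
    exact norm_sub_one_lt_one_of_pow_prime hp hpM hz1.le
      (ih (by rw [← pow_mul, ← pow_succ', hz]))

end Norm

/-! ### Artin-Hasse quotients and Artin-Hasse factorization -/

namespace PowerSeries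

section Padic

variable (p : ℕ) [hp : Fact p.Prime] {M : Type*} [NormedField M] [NormedAlgebra ℚ_[p] M]
  [IsUltrametricDist M]

/-- `B = E(z * X) / E(X)`, with `E` the Artin-Hasse exponential. -/
theorem exists_artinHasse_quotient {z : M} (hz : ‖z - 1‖ ≤ 1) :
    ∃ B : M⟦X⟧, IsExpOf (rescale z (frobSum M p) - frobSum M p) B ∧ CoeffLE 1 1 B ∧
      CoeffLE (‖z - 1‖ ^ 2) 1 (B - 1 - C (z - 1) * frobSum M p) := by
  have hz' : ‖z‖ ≤ 1 := by
    have := IsUltrametricDist.norm_add_le_max (z - 1) 1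
    rw [sub_add_cancel, norm_one] at this
    exact this.trans (max_le hz le_rfl)
  obtain ⟨E, hE, hE1⟩ := exists_artinHasse p M
  have hinv : E * E⁻¹ = 1 := PowerSeries.mul_inv_cancel E (by rw [hE.1]; exact one_ne_zero)
  have hE2 := hE1.inv zero_le_one hE.1
  have hzE : CoeffLE 1 1 (rescale z E) := fun n => by
    rw [coeff_rescale, norm_mul, norm_pow]
    exact (mul_le_of_le_one_left (norm_nonneg _) (pow_le_one₀ (norm_nonneg _) hz')).trans (hE1 n)
  refine ⟨E⁻¹ * rescale z E, ?_, ?_, ?_⟩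
  · refine hE.of_mul_right ?_
    rw [← mul_assoc, hinv, one_mul]
    exact hE.rescale z
  · simpa using hE2.mul hzE zero_le_one
  · have e : E⁻¹ * rescale z E - 1 - C (z - 1) * frobSum M p =
        E⁻¹ * (rescale z E - E - C (z - 1) * (X * d⁄dX M E)) := by
      rw [hE.2]
      linear_combination (-1 - C (z - 1) * frobSum M p) * (-hinv)
    rw [e, ← one_mul (‖z - 1‖ ^ 2)]
    refine hE2.mul (fun n => ?_) zero_le_one
    rw [map_sub, map_sub, coeff_rescale, coeff_C_mul, coeff_X_mul_derivative]
    have e2 : z ^ n * coeff n E - coeff n E - (z - 1) * (n * coeff n E) =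
        (z ^ n - 1 - (z - 1) * n) * coeff n E := by ring
    rw [e2, norm_mul]
    have h1 := hE1 n
    rw [one_pow, mul_one] at h1
    rw [one_pow]
    exact mul_le_mul (norm_pow_sub_one_sub_le hz' n) h1 (norm_nonneg _) (by positivity)

end Padic

/-- The coordinates of a power series with respect to its factorization, up to degree `D`, as a
product of series `E(c_n * X ^ n)`. -/
theorem exists_factorization {M : Type*} [NormedField M] [IsUltrametricDist M] {E g : M⟦X⟧}
    (hE0 : constantCoeff E = 1) (hE1 : coeff 1 E = 1)
    (hE : CoeffLE 1 1 E) (hg : constantCoeff g = 1) (D : ℕ) :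
    ∃ c : ℕ → M, (∀ m ≤ D, coeff m (∏ n ∈ Finset.Icc 1 D, scaledExpand n (c n) E) = coeff m g) ∧
      ∀ r : ℝ, 0 ≤ r → (∀ i ∈ Finset.Icc 1 D, ‖coeff i g‖ ≤ r ^ i) →
        ∀ n ∈ Finset.Icc 1 D, ‖c n‖ ≤ r ^ n := by
  induction D with
  | zero => exact ⟨0, by simp [hg], by simp⟩
  | succ D ih =>
    obtain ⟨c, hc, hr⟩ := ih
    set h := ∏ n ∈ Finset.Icc 1 D, scaledExpand n (c n) E with hh
    -- Since `E(b X ^ (D + 1)) = 1 + b X ^ (D + 1) + ⋯`, this `b` corrects degree `D + 1` without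
    -- disturbing lower degrees.
    set b := coeff (D + 1) g - coeff (D + 1) h with hb
    have hprod : ∏ n ∈ Finset.Icc 1 (D + 1),
        scaledExpand n (Function.update c (D + 1) b n) E = h * scaledExpand (D + 1) b E := by
      rw [Finset.prod_Icc_succ_top (by omega), Function.update_self, hh]
      congr 1
      refine Finset.prod_congr rfl fun n hn => ?_
      rw [Finset.mem_Icc] at hn
      rw [Function.update_of_ne (by omega)]
    have hd : (X : M⟦X⟧) ^ (D + 1) ∣ scaledExpand (D + 1) b E - 1 := by
      rw [X_pow_dvd_iff]
      intro m hm
      rw [map_sub, coeff_scaledExpand, coeff_one]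
      rcases Nat.eq_zero_or_pos m with rfl | h0
      · simp [hE0]
      · rw [if_neg (fun h => absurd (Nat.le_of_dvd h0 h) (by omega)), if_neg h0.ne', sub_zero]
    obtain ⟨u, hu⟩ := hd
    have hu0 : constantCoeff u = b := by
      have := congrArg (coeff (D + 1)) hu
      rw [coeff_X_pow_mul', if_pos le_rfl, Nat.sub_self, map_sub, coeff_scaledExpand, coeff_one,
        if_pos dvd_rfl, Nat.div_self (Nat.succ_pos D), hE1, if_neg (Nat.succ_ne_zero D)] at this
      rw [← coeff_zero_eq_constantCoeff_apply, ← this]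
      simp
    have h0 : constantCoeff h = 1 := by
      rw [← coeff_zero_eq_constantCoeff_apply, hc 0 (Nat.zero_le _),
        coeff_zero_eq_constantCoeff_apply, hg]
    have e : h * scaledExpand (D + 1) b E = h + X ^ (D + 1) * (h * u) := by
      linear_combination h * hu
    refine ⟨Function.update c (D + 1) b, fun m hm => ?_, fun r hr0 hgr n hn => ?_⟩
    · rw [hprod, e, map_add, coeff_X_pow_mul']
      rcases hm.lt_or_eq with h1 | rfl
      · rw [if_neg (by omega), add_zero, hc m (by omega)]
      · rw [if_pos le_rfl, Nat.sub_self, coeff_zero_eq_constantCoeff_apply, map_mul, h0, hu0, hb]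
        ring
    · have hr' := hr r hr0 fun i hi => hgr i (Finset.Icc_subset_Icc_right (Nat.le_succ D) hi)
      rw [Finset.mem_Icc] at hn
      rcases hn.2.lt_or_eq with h1 | rfl
      · rw [Function.update_of_ne (by omega)]
        exact hr' n (by rw [Finset.mem_Icc]; omega)
      · rw [Function.update_self, hb, sub_eq_add_neg]
        refine (IsUltrametricDist.norm_add_le_max _ _).trans (max_le (hgr _ (by simp)) ?_)
        have h2 : CoeffLE 1 r h := CoeffLE.prod hr0 fun n hn => hE.scaledExpand hr0 (hr' n hn)
        simpa using h2 (D + 1)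

end PowerSeries

/-! ### Root families: growth of `exp Q` against `exp Q̃` -/

namespace PowerSeries

/-- A family `z_n`, `1 ≤ n ≤ D`, of nontrivial roots of unity of `p`-power order that is compatible
with the maps `n ↦ p * n` and `z ↦ z ^ p`. -/
structure IsRootFamily {M : Type*} [NormedField M] (p D : ℕ) (z : ℕ → M) : Prop where
  ne_one : ∀ n ∈ Finset.Icc 1 D, z n ≠ 1
  norm_sub_one_lt : ∀ n ∈ Finset.Icc 1 D, ‖z n - 1‖ < 1
  norm_sub_one_le : ∀ m ∈ Finset.Icc 1 D, ∀ n ∈ Finset.Icc 1 D, m ≤ n → ‖z n - 1‖ ≤ ‖z m - 1‖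
  pow_eq : ∀ n k, 1 ≤ n → n * p ^ k ≤ D → z n ^ p ^ k = z (n * p ^ k)
  pow_eq_one : ∀ n ∈ Finset.Icc 1 D, ∀ k, D < n * p ^ k → z n ^ p ^ k = 1

/-- Finitely many strict inequalities `x_n < r ^ n` can be improved simultaneously. -/
theorem exists_lt_forall_le_pow {x : ℕ → ℝ} {r s : ℝ} (hs : 0 ≤ s) (hsr : s < r) (A : Finset ℕ)
    (hA : ∀ n ∈ A, n ≠ 0 ∧ 0 ≤ x n ∧ x n < r ^ n) :
    ∃ t, s ≤ t ∧ t < r ∧ ∀ n ∈ A, x n ≤ t ^ n := by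
  classical
  induction A using Finset.induction_on with
  | empty => exact ⟨s, le_rfl, hsr, by simp⟩
  | insert a A ha ih =>
    obtain ⟨t, ht, htr, h⟩ := ih fun n hn => hA n (Finset.mem_insert_of_mem hn)
    obtain ⟨ha0, hax, har⟩ := hA a (Finset.mem_insert_self a A)
    have e : (x a ^ (a⁻¹ : ℝ)) ^ a = x a := Real.rpow_inv_natCast_pow hax ha0
    refine ⟨max t (x a ^ (a⁻¹ : ℝ)), ht.trans (le_max_left _ _), max_lt htr ?_, fun n hn => ?_⟩
    · refine lt_of_pow_lt_pow_left₀ a (hs.trans hsr.le) ?_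
      rwa [e]
    · rcases Finset.mem_insert.1 hn with rfl | hn
      · calc x n = (x n ^ (n⁻¹ : ℝ)) ^ n := e.symm
          _ ≤ _ := pow_le_pow_left₀ (by positivity) (le_max_right _ _) n
      · exact (h n hn).trans (pow_le_pow_left₀ (hs.trans ht) (le_max_left _ _) n)

theorem coeff_scaledExpand_frobSum_eq {R : Type*} [CommRing R] {p n : ℕ} (hn : n ≠ 0) (c : R)
    (k : ℕ) : coeff (n * p ^ k) (scaledExpand n c (frobSum R p)) = c ^ p ^ k := by
  rw [coeff_scaledExpand, if_pos (dvd_mul_right _ _),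
    Nat.mul_div_cancel_left _ (Nat.pos_of_ne_zero hn), coeff_frobSum, if_pos ⟨k, rfl⟩, mul_one]

theorem coeff_scaledExpand_frobSum_eq_zero {R : Type*} [CommRing R] {p n m : ℕ} (c : R)
    (h : ∀ k, m ≠ n * p ^ k) : coeff m (scaledExpand n c (frobSum R p)) = 0 := by
  rw [coeff_scaledExpand]
  split_ifs with hd
  · rw [coeff_frobSum, if_neg, mul_zero]
    rintro ⟨k, hk⟩
    exact h k (by rw [← hk, Nat.mul_div_cancel' hd])
  · rfl

theorem coeff_scaledExpand_rescale_frobSum_eq {R : Type*} [CommRing R] {p n : ℕ} (hn : n ≠ 0)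
    (c z : R) (k : ℕ) :
    coeff (n * p ^ k) (scaledExpand n c (rescale z (frobSum R p) - frobSum R p)) =
      (z ^ p ^ k - 1) * c ^ p ^ k := by
  rw [coeff_scaledExpand, if_pos (dvd_mul_right _ _),
    Nat.mul_div_cancel_left _ (Nat.pos_of_ne_zero hn), map_sub, coeff_rescale, coeff_frobSum,
    if_pos ⟨k, rfl⟩]
  ring

theorem coeff_scaledExpand_rescale_frobSum_eq_zero {R : Type*} [CommRing R] {p n m : ℕ} (c z : R)
    (h : ∀ k, m ≠ n * p ^ k) :
    coeff m (scaledExpand n c (rescale z (frobSum R p) - frobSum R p)) = 0 := by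
  rw [coeff_scaledExpand]
  split_ifs with hd
  · rw [map_sub, coeff_rescale, coeff_frobSum, if_neg, mul_zero, sub_zero, mul_zero]
    rintro ⟨k, hk⟩
    exact h k (by rw [← hk, Nat.mul_div_cancel' hd])
  · rfl

variable {p : ℕ} [hp : Fact p.Prime] {M : Type*} [NormedField M] [NormedAlgebra ℚ_[p] M]
  [IsUltrametricDist M] {D : ℕ} {z : ℕ → M}

/-- The common factorization of `exp Q` and `exp Q̃`. -/
theorem IsRootFamily.exists_factorization [CharZero M] (hz : IsRootFamily p D z)
    {f g W V : M⟦X⟧} (hf : IsExpOf W f)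
    (hg : IsExpOf V g) (hWD : ∀ n, D < n → coeff n W = 0)
    (hWV : ∀ n ∈ Finset.Icc 1 D, coeff n W = (z n - 1) * coeff n V) :
    ∃ (c : ℕ → M) (E : M⟦X⟧) (B : ℕ → M⟦X⟧), CoeffLE 1 1 E ∧
      (∀ n ∈ Finset.Icc 1 D, constantCoeff (B n) = 1 ∧ CoeffLE 1 1 (B n) ∧
        CoeffLE (‖z n - 1‖ ^ 2) 1 (B n - 1 - C (z n - 1) * frobSum M p)) ∧
      (∀ m ≤ D, coeff m (∏ n ∈ Finset.Icc 1 D, scaledExpand n (c n) E) = coeff m g) ∧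
      f = ∏ n ∈ Finset.Icc 1 D, scaledExpand n (c n) (B n) ∧
      ∀ r : ℝ, 0 ≤ r → (∀ i ∈ Finset.Icc 1 D, ‖coeff i g‖ ≤ r ^ i) →
        ∀ n ∈ Finset.Icc 1 D, ‖c n‖ ≤ r ^ n := by
  obtain ⟨E, hE, hE1⟩ := exists_artinHasse p M
  have hE2 : coeff 1 E = 1 := by
    have := congrArg (coeff 1) hE.2
    rw [coeff_X_mul_derivative, coeff_mul, Finset.Nat.antidiagonal_succ] at this
    simpa [coeff_frobSum, hE.1, hp.out.ne_zero, eq_comm] using this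
  obtain ⟨c, hc, hcr⟩ := PowerSeries.exists_factorization hE.1 hE2 hE1 hg.1 D
  have hB : ∀ n, ∃ B : M⟦X⟧, n ∈ Finset.Icc 1 D →
      IsExpOf (rescale (z n) (frobSum M p) - frobSum M p) B ∧ CoeffLE 1 1 B ∧
      CoeffLE (‖z n - 1‖ ^ 2) 1 (B - 1 - C (z n - 1) * frobSum M p) := by
    intro n
    by_cases hn : n ∈ Finset.Icc 1 D
    · obtain ⟨B, hB⟩ := exists_artinHasse_quotient p (hz.norm_sub_one_lt n hn).le
      exact ⟨B, fun _ => hB⟩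
    · exact ⟨0, fun h => absurd h hn⟩
  choose B hB using hB
  have hG := IsExpOf.prod (Finset.Icc 1 D) (f := fun n => scaledExpand n (c n) E)
    fun n hn => hE.scaledExpand (by rw [Finset.mem_Icc] at hn; omega) (c n)
  have hF := IsExpOf.prod (Finset.Icc 1 D) (f := fun n => scaledExpand n (c n) (B n))
    fun n hn => (hB n hn).1.scaledExpand (by rw [Finset.mem_Icc] at hn; omega) (c n)
  -- The product matches `g` only up to degree `D`, which suffices because `W` vanishes beyond `D`.
  have hV := hG.coeff_logDeriv_congr hg hc
  refine ⟨c, E, B, hE1, fun n hn => ⟨(hB n hn).1.1, (hB n hn).2⟩, hc, ?_, hcr⟩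
  refine hf.unique ?_
  convert hF using 1
  ext m
  rcases Nat.eq_zero_or_pos m with rfl | hm
  · have h0 : ∀ {W f : M⟦X⟧}, IsExpOf W f → coeff 0 W = 0 := by
      intro W f h
      have := congrArg (coeff 0) h.2
      simpa [h.1] using this.symm
    rw [h0 hf, h0 hF]
  -- In degree `m = n p ^ k` the factor `z_n ^ (p ^ k) - 1` is `z_m - 1`, independent of `n`, if `m
  -- ≤ D`, and `0` beyond. Thus the product gives `f` exactly.
  have key : ∀ n ∈ Finset.Icc 1 D,
      coeff m ((n : M⟦X⟧) * scaledExpand n (c n) (rescale (z n) (frobSum M p) - frobSum M p)) =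
      if m ≤ D then (z m - 1) * coeff m ((n : M⟦X⟧) * scaledExpand n (c n) (frobSum M p))
      else 0 := by
    intro n hn
    have hn0 : n ≠ 0 := by rw [Finset.mem_Icc] at hn; omega
    rw [← map_natCast C, coeff_C_mul, coeff_C_mul]
    by_cases h : ∃ k, m = n * p ^ k
    · obtain ⟨k, rfl⟩ := h
      rw [coeff_scaledExpand_rescale_frobSum_eq hn0, coeff_scaledExpand_frobSum_eq hn0]
      split_ifs with hD
      · rw [hz.pow_eq n k (by omega) hD]; ring
      · rw [hz.pow_eq_one n hn k (by omega)]; ring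
    · push Not at h
      rw [coeff_scaledExpand_rescale_frobSum_eq_zero _ _ h, coeff_scaledExpand_frobSum_eq_zero _ h]
      simp
  rw [map_sum, Finset.sum_congr rfl key]
  split_ifs with hD
  · rw [← Finset.mul_sum, ← map_sum, hV m hD, hWV m (Finset.mem_Icc.2 ⟨hm, hD⟩)]
  · rw [Finset.sum_const_zero, hWD m (by omega)]

theorem IsRootFamily.coeffLE [CharZero M] (hz : IsRootFamily p D z) {f g W V : M⟦X⟧}
    (hf : IsExpOf W f)
    (hg : IsExpOf V g) (hWD : ∀ n, D < n → coeff n W = 0)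
    (hWV : ∀ n ∈ Finset.Icc 1 D, coeff n W = (z n - 1) * coeff n V) {r : ℝ} (hr : 0 ≤ r)
    (h : ∀ i ∈ Finset.Icc 1 D, ‖coeff i g‖ ≤ r ^ i) : CoeffLE 1 r f := by
  obtain ⟨c, E, B, -, hB, -, rfl, hc⟩ := hz.exists_factorization hf hg hWD hWV
  exact CoeffLE.prod hr fun n hn => (hB n hn).2.1.scaledExpand hr (hc r hr h n hn)

/-- The leading behaviour of a product of Artin-Hasse quotients all of whose coordinates have the
largest possible norm. -/
theorem IsRootFamily.le_norm_coeff_prod (hz : IsRootFamily p D z) {A : Finset ℕ}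
    (hA : A ⊆ Finset.Icc 1 D) (hne : A.Nonempty) {r : ℝ} (hr : 0 ≤ r) {c : ℕ → M}
    (hc : ∀ n ∈ A, ‖c n‖ = r ^ n) {B : ℕ → M⟦X⟧}
    (hB : ∀ n ∈ A, CoeffLE (‖z n - 1‖ ^ 2) 1 (B n - 1 - C (z n - 1) * frobSum M p)) (k : ℕ) :
    ‖z (A.min' hne) - 1‖ * r ^ (A.min' hne * p ^ k) ≤
      ‖coeff (A.min' hne * p ^ k) (∏ n ∈ A, scaledExpand n (c n) (B n))‖ := by
  set n₀ := A.min' hne with hn₀_def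
  set e := ‖z n₀ - 1‖ with he_def
  set m := n₀ * p ^ k with hm_def
  have hn₀A : n₀ ∈ A := A.min'_mem hne
  have hn₀ := hA hn₀A
  have hn₀1 := Finset.mem_Icc.1 hn₀
  have he1 : e < 1 := hz.norm_sub_one_lt n₀ hn₀
  have he0 : 0 < e := norm_pos_iff.2 (sub_ne_zero.2 (hz.ne_one n₀ hn₀))
  have hle : ∀ n ∈ A, ‖z n - 1‖ ≤ e := fun n hn =>
    hz.norm_sub_one_le n₀ hn₀ n (hA hn) (A.min'_le n hn)
  have hm : m ≠ 0 := Nat.mul_ne_zero (by omega) (pow_pos hp.out.pos k).ne'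
  have hB2 : ∀ n ∈ A, CoeffLE (e ^ 2) 1 (B n - 1 - C (z n - 1) * frobSum M p) := fun n hn =>
    (hB n hn).mono zero_le_one (pow_le_pow_left₀ (norm_nonneg _) (hle n hn) 2)
  have hB1 : ∀ n ∈ A, CoeffLE e 1 (B n - 1) := fun n hn => by
    have h : CoeffLE e 1 (C (z n - 1) * frobSum M p) := fun i => by
      rw [coeff_C_mul, norm_mul, coeff_frobSum, one_pow]
      refine mul_le_mul (hle n hn) ?_ (norm_nonneg _) he0.le
      split_ifs <;> simp
    simpa using ((hB2 n hn).mono zero_le_one (by nlinarith)).add h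
  have hsub : ∀ n ∈ A, scaledExpand n (c n) (B n) - 1 = scaledExpand n (c n) (B n - 1) := by
    intro n hn
    have hn0 : n ≠ 0 := by have := Finset.mem_Icc.1 (hA hn); omega
    simp only [scaledExpand_eq hn0, map_sub, map_one]
  obtain ⟨-, h1⟩ := CoeffLE.prod_sub_one_sub_sum hr he0.le he1.le
    (f := fun n => scaledExpand n (c n) (B n)) (s := A) fun n hn => by
      rw [hsub n hn]
      exact (hB1 n hn).scaledExpand hr (hc n hn).le
  have h2 : CoeffLE (e ^ 2) r (∑ n ∈ A,
      scaledExpand n (c n) (B n - 1 - C (z n - 1) * frobSum M p)) :=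
    CoeffLE.sum (by positivity) hr fun n hn => (hB2 n hn).scaledExpand hr (hc n hn).le
  have hsplit : ∑ n ∈ A, (scaledExpand n (c n) (B n) - 1) =
      ∑ n ∈ A, scaledExpand n (c n) (B n - 1 - C (z n - 1) * frobSum M p) +
        ∑ n ∈ A, C (z n - 1) * scaledExpand n (c n) (frobSum M p) := by
    rw [← Finset.sum_add_distrib]
    refine Finset.sum_congr rfl fun n hn => ?_
    rw [hsub n hn]
    ext i
    generalize z n - 1 = w
    simp only [map_add, coeff_C_mul, coeff_scaledExpand, map_sub]
    split_ifs <;> ring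
  have h1' := h1 m
  rw [hsplit, ← Finset.add_sum_erase A (fun n => C (z n - 1) * scaledExpand n (c n) (frobSum M p))
    hn₀A] at h1'
  have h2' := h2 m
  set R := ∑ n ∈ A, scaledExpand n (c n) (B n - 1 - C (z n - 1) * frobSum M p)
  rw [map_sub, map_sub, map_add, map_add, coeff_one, if_neg hm, sub_zero, coeff_C_mul,
    coeff_scaledExpand_frobSum_eq (by omega)] at h1'
  set b := coeff m (∑ n ∈ A.erase n₀, C (z n - 1) * scaledExpand n (c n) (frobSum M p)) with hb
  have hbn : ‖b‖ ≤ ‖z n₀ ^ p - 1‖ * r ^ m := by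
    rw [hb, map_sum]
    refine IsUltrametricDist.norm_sum_le_of_forall_le_of_nonneg (by positivity) fun n hn => ?_
    rw [Finset.mem_erase] at hn
    have hn0 := Finset.mem_Icc.1 (hA hn.2)
    rw [coeff_C_mul]
    -- An index `n > n₀` reaching degree `m` is some `n₀ p ^ (j + 1)`, so `z n` is a power of `z n₀
    -- ^ p` and lies strictly closer to `1` than `z n₀`.
    by_cases h : ∃ l, m = n * p ^ l
    · obtain ⟨l, hl⟩ := h
      have hlt : n₀ < n := lt_of_le_of_ne (A.min'_le n hn.2) (Ne.symm hn.1)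
      have hlk : l < k := by
        by_contra hlk
        have := Nat.pow_le_pow_right hp.out.pos (not_lt.1 hlk)
        have h3 : n₀ * p ^ k < n * p ^ l :=
          Nat.mul_lt_mul_of_lt_of_le hlt this (pow_pos hp.out.pos l)
        omega
      obtain ⟨j, rfl⟩ := Nat.exists_eq_add_of_lt hlk
      have hnn : n = n₀ * p ^ (j + 1) := by
        refine Nat.eq_of_mul_eq_mul_right (pow_pos hp.out.pos l) ?_
        rw [← hl, hm_def]; ring
      rw [hl, coeff_scaledExpand_frobSum_eq (by omega), norm_mul, norm_pow, hc n hn.2, ← pow_mul]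
      refine mul_le_mul_of_nonneg_right ?_ (by positivity)
      have hzn : z n = (z n₀ ^ p) ^ p ^ j := by
        rw [← pow_mul, ← pow_succ', hz.pow_eq n₀ (j + 1) hn₀1.1 (by rw [← hnn]; exact hn0.2), hnn]
      rw [hzn]
      refine norm_pow_sub_one_le ?_ _
      have hz1 : ‖z n₀‖ ≤ 1 := by
        have := IsUltrametricDist.norm_add_le_max (z n₀ - 1) 1
        rw [sub_add_cancel, norm_one] at this
        exact this.trans (max_le he1.le le_rfl)
      rw [norm_pow]
      exact pow_le_one₀ (norm_nonneg _) hz1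
    · push Not at h
      rw [coeff_scaledExpand_frobSum_eq_zero _ h, mul_zero, norm_zero]
      positivity
  have hp1 : ‖(p : M)‖ < 1 := by
    rw [← map_natCast (algebraMap ℚ_[p] M), norm_algebraMap', Padic.norm_p]
    exact inv_lt_one_of_one_lt₀ (by exact_mod_cast hp.out.one_lt)
  have hzp : ‖z n₀ ^ p - 1‖ < e := norm_pow_sub_one_lt (hz.ne_one n₀ hn₀) he1 hp1
  by_contra! hlt
  have hrm : 0 < r ^ m := pos_of_mul_pos_right ((norm_nonneg _).trans_lt hlt) he0.le
  have ha : ‖(z n₀ - 1) * c n₀ ^ p ^ k‖ = e * r ^ m := by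
    rw [norm_mul, norm_pow, hc n₀ hn₀A, ← pow_mul]
  have hee : e ^ 2 * r ^ m < e * r ^ m := mul_lt_mul_of_pos_right (by nlinarith) hrm
  have key : ∀ x y : M, ‖x‖ < e * r ^ m → ‖y‖ < e * r ^ m → ‖x - y‖ < e * r ^ m := by
    intro x y hx hy
    rw [sub_eq_add_neg]
    exact (IsUltrametricDist.norm_add_le_max _ _).trans_lt (max_lt hx (by rwa [norm_neg]))
  -- The leading term is the coefficient minus two second-order errors and `b`; all four would have
  -- norm below that of the leading term.
  have hfin := key _ _ (key _ _ (key _ _ hlt (h1'.trans_lt hee)) (h2'.trans_lt hee))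
    (hbn.trans_lt (mul_lt_mul_of_pos_right hzp hrm))
  refine absurd hfin (not_lt.2 (ha.symm.le.trans_eq ?_))
  congr 1
  ring

/-- The bound `r` is attained by some `g_i`, so it is attained by some coordinate `c_n`, and the
factors attaining it keep `f` from growing more slowly. -/
theorem IsRootFamily.not_coeffLE [CharZero M] (hz : IsRootFamily p D z) {f g W V : M⟦X⟧}
    (hf : IsExpOf W f)
    (hg : IsExpOf V g) (hWD : ∀ n, D < n → coeff n W = 0)
    (hWV : ∀ n ∈ Finset.Icc 1 D, coeff n W = (z n - 1) * coeff n V) {r s K : ℝ} (hs : 0 ≤ s)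
    (hsr : s < r) (h : ∀ i ∈ Finset.Icc 1 D, ‖coeff i g‖ ≤ r ^ i)
    (h' : ∃ i ∈ Finset.Icc 1 D, ‖coeff i g‖ = r ^ i) : ¬ CoeffLE K s f := by
  classical
  intro hK
  have hr := hs.trans hsr.le
  obtain ⟨c, E, B, hE, hB, hcE, hfB, hc⟩ := hz.exists_factorization hf hg hWD hWV
  have hcr := hc r hr h
  set A := {n ∈ Finset.Icc 1 D | ‖c n‖ = r ^ n} with hA
  have hAD : A ⊆ Finset.Icc 1 D := Finset.filter_subset _ _
  obtain ⟨t, hst, htr, ht⟩ := exists_lt_forall_le_pow (x := fun n => ‖c n‖) hs hsr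
    {n ∈ Finset.Icc 1 D | ¬ ‖c n‖ = r ^ n} (by
      intro n hn
      rw [Finset.mem_filter] at hn
      have hn' := Finset.mem_Icc.1 hn.1
      exact ⟨by omega, norm_nonneg _, lt_of_le_of_ne (hcr n hn.1) hn.2⟩)
  have ht0 := hs.trans hst
  -- Otherwise every `c n` is bounded by `t ^ n` with `t < r`, and so are all `g_i` with `i ≤ D`,
  -- against `h'`.
  have hne : A.Nonempty := by
    by_contra hem
    rw [Finset.not_nonempty_iff_eq_empty, hA, Finset.filter_eq_empty_iff] at hem
    obtain ⟨i, hi, hir⟩ := h'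
    have h1 : CoeffLE 1 t (∏ n ∈ Finset.Icc 1 D, scaledExpand n (c n) E) :=
      CoeffLE.prod ht0 fun n hn => hE.scaledExpand ht0
        (ht n (Finset.mem_filter.2 ⟨hn, hem hn⟩))
    have h2 := h1 i
    have hi' := Finset.mem_Icc.1 hi
    rw [hcE i hi'.2, hir, one_mul] at h2
    exact absurd h2 (not_le.2 (pow_lt_pow_left₀ htr ht0 (by omega)))
  set G := ∏ n ∈ Finset.Icc 1 D with ¬ ‖c n‖ = r ^ n, scaledExpand n (c n) (B n) with hG
  have hGt : CoeffLE 1 t G := CoeffLE.prod ht0 fun n hn =>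
    (hB n (Finset.mem_filter.1 hn).1).2.1.scaledExpand ht0 (ht n hn)
  have hG0 : constantCoeff G = 1 := by
    rw [hG, map_prod]
    refine Finset.prod_eq_one fun n hn => ?_
    rw [← coeff_zero_eq_constantCoeff_apply, coeff_scaledExpand]
    simp [(hB n (Finset.mem_filter.1 hn).1).1]
  have hFG : (∏ n ∈ A, scaledExpand n (c n) (B n)) = f * G⁻¹ := by
    rw [hfB, ← Finset.prod_filter_mul_prod_filter_not (Finset.Icc 1 D) (fun n => ‖c n‖ = r ^ n),
      mul_assoc, PowerSeries.mul_inv_cancel G (by rw [hG0]; exact one_ne_zero), mul_one]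
  have hF : CoeffLE K t (∏ n ∈ A, scaledExpand n (c n) (B n)) := by
    rw [hFG, ← mul_one K]
    exact (hK.mono_radius hK.nonneg hs hst).mul (hGt.inv ht0 hG0) ht0
  have hlow := hz.le_norm_coeff_prod hAD hne hr (c := c) (B := B)
    (fun n hn => (Finset.mem_filter.1 hn).2) fun n hn => (hB n (hAD hn)).2.2
  set n₀ := A.min' hne
  have hn₀ : n₀ ∈ Finset.Icc 1 D := hAD (A.min'_mem hne)
  have he : 0 < ‖z n₀ - 1‖ := norm_pos_iff.2 (sub_ne_zero.2 (hz.ne_one n₀ hn₀))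
  have hr0 : 0 < r := ht0.trans_lt htr
  have hlim : Filter.Tendsto (fun m : ℕ => K * (t / r) ^ m) Filter.atTop (nhds (K * 0)) :=
    (tendsto_pow_atTop_nhds_zero_of_lt_one (by positivity) ((div_lt_one hr0).2 htr)).const_mul K
  rw [mul_zero] at hlim
  obtain ⟨N, hN⟩ := Filter.eventually_atTop.1 (hlim.eventually_lt_const he)
  -- The degrees `n₀ p ^ k` are unbounded, so one lies where `K (t / r) ^ m` is below `‖z n₀ - 1‖`.
  have h1 : N ≤ n₀ * p ^ N := by
    have := (Nat.lt_pow_self hp.out.one_lt (n := N)).le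
    exact this.trans (Nat.le_mul_of_pos_left _ (Finset.mem_Icc.1 hn₀).1)
  have h2 := hN _ h1
  have h3 := (hlow N).trans (hF _)
  rw [div_pow, ← mul_div_assoc, div_lt_iff₀ (by positivity)] at h2
  exact absurd h3 (not_le.2 h2)

end PowerSeries

/-! ### Radius of convergence and geometric bounds -/

section Radius

theorem enorm_rpow_one_div_le_iff {F : Type*} [NormedField F] (x : F) {n : ℕ} (hn : n ≠ 0) {t : ℝ}
    (ht : 0 ≤ t) : ‖x‖ₑ ^ (1 / (n : ℝ)) ≤ ENNReal.ofReal t ↔ ‖x‖ ≤ t ^ n := by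
  rw [one_div, ENNReal.rpow_inv_le_iff (by positivity), ENNReal.rpow_natCast,
    ← ENNReal.ofReal_pow ht, ← ofReal_norm, ENNReal.ofReal_le_ofReal_iff (by positivity)]

theorem norm_eq_pow_of_enorm_rpow_eq {F : Type*} [NormedField F] {x : F} {n : ℕ} (hn : n ≠ 0)
    {t : ℝ} (ht : 0 ≤ t) (h : ‖x‖ₑ ^ (1 / (n : ℝ)) = ENNReal.ofReal t) : ‖x‖ = t ^ n := by
  have e := ENNReal.rpow_inv_natCast_pow hn ‖x‖ₑ
  rw [← one_div, h, ← ENNReal.ofReal_pow ht, ← ofReal_norm] at e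
  exact ((ENNReal.ofReal_eq_ofReal_iff (by positivity) (norm_nonneg _)).1 e).symm

open Filter in
theorem PowerSeries.CoeffLE.limsup_le {F : Type*} [NormedField F] {y : PowerSeries F} {K r : ℝ}
    (hr : 0 ≤ r) (h : PowerSeries.CoeffLE K r y) :
    limsup (fun n : ℕ => ‖PowerSeries.coeff n y‖ₑ ^ (1 / (n : ℝ))) atTop ≤ ENNReal.ofReal r := by
  refine le_of_forall_gt fun b hb => ?_
  obtain ⟨t, ht1, ht2⟩ := ENNReal.lt_iff_exists_nnreal_btwn.1 hb
  rw [← ENNReal.ofReal_coe_nnreal, ENNReal.ofReal_lt_ofReal_iff_of_nonneg hr] at ht1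
  refine lt_of_le_of_lt ?_ ht2
  have ht0 : (0 : ℝ) < t := hr.trans_lt ht1
  have hlim : Tendsto (fun m : ℕ => K * (r / t) ^ m) atTop (nhds (K * 0)) :=
    (tendsto_pow_atTop_nhds_zero_of_lt_one (by positivity) ((div_lt_one ht0).2 ht1)).const_mul K
  rw [mul_zero] at hlim
  refine limsup_le_of_le (by isBoundedDefault) ?_
  filter_upwards [hlim.eventually_lt_const one_pos, eventually_ne_atTop 0] with n hn hn0
  rw [← ENNReal.ofReal_coe_nnreal, enorm_rpow_one_div_le_iff _ hn0 ht0.le]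
  rw [div_pow, ← mul_div_assoc, div_lt_one (by positivity)] at hn
  exact (h n).trans hn.le

open Filter in
theorem PowerSeries.exists_coeffLE_of_limsup_lt {F : Type*} [NormedField F] {y : PowerSeries F}
    {r : ℝ} (h : limsup (fun n : ℕ => ‖PowerSeries.coeff n y‖ₑ ^ (1 / (n : ℝ))) atTop <
      ENNReal.ofReal r) : ∃ s K : ℝ, 0 ≤ s ∧ s < r ∧ PowerSeries.CoeffLE K s y := by
  obtain ⟨t, ht1, ht2⟩ := ENNReal.lt_iff_exists_nnreal_btwn.1 h
  have ht0 : (0 : ℝ) < t := by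
    have := pos_of_gt ht1
    exact_mod_cast this
  have htr : (t : ℝ) < r := by
    rw [← ENNReal.ofReal_coe_nnreal] at ht2
    exact (ENNReal.ofReal_lt_ofReal_iff_of_nonneg t.2).1 ht2
  obtain ⟨N, hN⟩ := eventually_atTop.1 (eventually_lt_of_limsup_lt ht1)
  -- The sum absorbs the finitely many degrees up to `N`; the summand `1` serves the later ones.
  refine ⟨t, 1 + ∑ i ∈ Finset.range (N + 1), ‖PowerSeries.coeff i y‖ / (t : ℝ) ^ i, ht0.le, htr,
    fun n => ?_⟩
  have hsum : 0 ≤ ∑ i ∈ Finset.range (N + 1), ‖PowerSeries.coeff i y‖ / (t : ℝ) ^ i :=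
    Finset.sum_nonneg fun i _ => by positivity
  rcases le_or_gt n N with hn | hn
  · rw [← div_le_iff₀ (by positivity)]
    have := Finset.single_le_sum (f := fun i => ‖PowerSeries.coeff i y‖ / (t : ℝ) ^ i)
      (fun i _ => by positivity) (Finset.mem_range.2 (Nat.lt_succ_of_le hn))
    linarith
  · have := (hN n hn.le).le
    rw [← ENNReal.ofReal_coe_nnreal, enorm_rpow_one_div_le_iff _ (by omega) ht0.le] at this
    refine this.trans (le_mul_of_one_le_left (by positivity) (by linarith))

end Radius

/-! ### The roots of unity `ζ_{d_n}` -/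

section RootFamily

theorem truncLen_anti (p D : ℕ) {m n : ℕ} (hm : 1 ≤ m) (h : m ≤ n) :
    truncLen p D n ≤ truncLen p D m :=
  Nat.log_mono_right (Nat.div_le_div_left h hm)

theorem truncLen_mul_pow (p D n k : ℕ) : truncLen p D (n * p ^ k) = truncLen p D n - k := by
  induction k with
  | zero => simp
  | succ k ih =>
    rw [pow_succ, ← mul_assoc, truncLen, ← Nat.div_div_eq_div_mul, Nat.log_div_base]
    rw [truncLen] at ih
    rw [ih, Nat.sub_sub]

theorem le_truncLen_iff {p D n k : ℕ} (hp : 1 < p) (hn : n ∈ Finset.Icc 1 D) :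
    k ≤ truncLen p D n ↔ n * p ^ k ≤ D := by
  rw [Finset.mem_Icc] at hn
  rw [truncLen, Nat.le_log_iff_pow_le hp (Nat.div_pos hn.2 (by omega)).ne',
    Nat.le_div_iff_mul_le (by omega), mul_comm]

/-- The order of `z_n` is `p ^ (d_n + 1)`, `d_{n p ^ k} = d_n - k`, and `k ≤ d_n` exactly when `n p
^ k ≤ D`. -/
theorem isRootFamily_rootAt (p : ℕ) [hp : Fact p.Prime] {M : Type*} [NormedField M]
    [NormedAlgebra ℚ_[p] M] [IsUltrametricDist M] {D : ℕ} {ζ : M}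
    (hζ : IsPrimitiveRoot ζ (p ^ (Nat.log p D + 1))) :
    PowerSeries.IsRootFamily p D (rootAt p D ζ) := by
  have hp1 := hp.out.one_lt
  have hpM : ‖(p : M)‖ < 1 := by
    rw [← map_natCast (algebraMap ℚ_[p] M), norm_algebraMap', Padic.norm_p]
    exact inv_lt_one_of_one_lt₀ (by exact_mod_cast hp1)
  have hd : Nat.log p D = truncLen p D 1 := by rw [truncLen, Nat.div_one]
  rw [hd] at hζ
  have hle : ∀ n ∈ Finset.Icc 1 D, truncLen p D n ≤ truncLen p D 1 := fun n hn =>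
    truncLen_anti p D le_rfl (Finset.mem_Icc.1 hn).1
  have hone : ∀ n, rootAt p D ζ n ^ p ^ (truncLen p D 1 + 1) = 1 := fun n => by
    rw [rootAt, ← pow_mul, mul_comm, pow_mul, hζ.pow_eq_one, one_pow]
  have hlt : ∀ n, ‖rootAt p D ζ n - 1‖ < 1 := fun n =>
    norm_sub_one_lt_one_of_pow_prime_pow_eq_one hp.out hpM (hone n)
  have hnorm : ∀ n, ‖rootAt p D ζ n‖ ≤ 1 := fun n => by
    have := IsUltrametricDist.norm_add_le_max (rootAt p D ζ n - 1) 1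
    rw [sub_add_cancel, norm_one] at this
    exact this.trans (max_le (hlt n).le le_rfl)
  refine ⟨fun n hn h => ?_, fun n _ => hlt n, fun m hm n hn hmn => ?_, fun n k hn hk => ?_,
    fun n hn k hk => ?_⟩
  · have := (Nat.pow_dvd_pow_iff_le_right hp1).1 ((hζ.pow_eq_one_iff_dvd _).1 h)
    omega
  · have h1 := hle m hm
    have h2 := truncLen_anti p D (Finset.mem_Icc.1 hm).1 hmn
    have e : rootAt p D ζ n = rootAt p D ζ m ^ p ^ (truncLen p D m - truncLen p D n) := by
      rw [rootAt, rootAt, ← pow_mul, ← pow_add]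
      congr 2
      omega
    rw [e]
    exact norm_pow_sub_one_le (hnorm m) _
  · have hnD : n ∈ Finset.Icc 1 D :=
      Finset.mem_Icc.2 ⟨hn, (Nat.le_mul_of_pos_right n (pow_pos hp.out.pos k)).trans hk⟩
    have h1 := hle n hnD
    have h2 := (le_truncLen_iff hp1 hnD).2 hk
    rw [rootAt, rootAt, ← pow_mul, ← pow_add, truncLen_mul_pow]
    congr 2
    omega
  · have h1 := hle n hn
    have h2 := mt (le_truncLen_iff hp1 hn).1 (not_le.2 hk)
    rw [rootAt, ← pow_mul, ← pow_add, hζ.pow_eq_one_iff_dvd]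
    exact pow_dvd_pow p (by omega)

end RootFamily

/-! ### The differential equation and the radius formula -/

section Equation

open PowerSeries in
/-- A power series with `X * y' = W * y` is a constant multiple of the exponential. -/
theorem PowerSeries.IsExpOf.eq_C_mul {F : Type*} [Field F] [CharZero F] {W f y : PowerSeries F}
    (hf : PowerSeries.IsExpOf W f) (hy : PowerSeries.X * d⁄dX F y = W * y) :
    y = PowerSeries.C (PowerSeries.constantCoeff y) * f := by
  have h : IsExpOf W (f + (y - PowerSeries.C (PowerSeries.constantCoeff y) * f)) := by
    refine ⟨by simp [hf.1], ?_⟩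
    have h2 := hf.2
    simp only [map_add, map_sub, Derivation.leibniz, derivative_C, smul_eq_mul]
    linear_combination h2 + hy - PowerSeries.C (PowerSeries.constantCoeff y) * h2
  have := h.unique hf
  linear_combination this

theorem Polynomial.derivative_taylor {R : Type*} [CommRing R] (r : R) (f : R[X]) :
    derivative (taylor r f) = taylor r (derivative f) := by
  simp [taylor_apply, derivative_comp]

theorem aeval_coeff_translatedPoly {K E M : Type*} [Field K] [Field E] [CommRing M] [Algebra K E]
    [Algebra E M] [Algebra K M] [IsScalarTower K E M] (P : K[X]) (b : M) (n : ℕ) :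
    aeval b (((translatedPoly P).coeff n).map (algebraMap K E)) =
      (taylor b (P.map (algebraMap K M))).coeff n := by
  rw [aeval_map_algebraMap, translatedPoly]
  have h := congrArg (fun q => q.coeff n)
    (map_taylor (P.map C) (X : K[X]) (aeval b : K[X] →ₐ[K] M).toRingHom)
  simp only [coeff_map, Polynomial.map_map] at h
  have e : ((aeval b : K[X] →ₐ[K] M).toRingHom).comp C = algebraMap K M := by
    ext x; simp
  rw [e] at h
  simpa using h

end Equation
open PowerSeries Filter in
/-- The radius of convergence of a multiple of `exp Q` in terms of the coefficients of `exp Q̃`. -/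
theorem PowerSeries.IsRootFamily.limsup_eq {p : ℕ} [Fact p.Prime] {M : Type*} [NormedField M]
    [NormedAlgebra ℚ_[p] M] [IsUltrametricDist M] [CharZero M] {D : ℕ} {z : ℕ → M}
    (hz : PowerSeries.IsRootFamily p D z) {f g W V : PowerSeries M} (hf : PowerSeries.IsExpOf W f)
    (hg : PowerSeries.IsExpOf V g) (hWD : ∀ n, D < n → PowerSeries.coeff n W = 0)
    (hWV : ∀ n ∈ Finset.Icc 1 D, PowerSeries.coeff n W = (z n - 1) * PowerSeries.coeff n V)
    {b : M} (hb : b ≠ 0) :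
    limsup (fun n : ℕ => ‖PowerSeries.coeff n (PowerSeries.C b * f)‖ₑ ^ (1 / (n : ℝ))) atTop =
      (Finset.Icc 1 D).sup fun i : ℕ => ‖PowerSeries.coeff i g‖ₑ ^ (1 / (i : ℝ)) := by
  set T := (Finset.Icc 1 D).sup fun i : ℕ => ‖PowerSeries.coeff i g‖ₑ ^ (1 / (i : ℝ)) with hT
  have hTtop : T ≠ ⊤ := by
    refine ((Finset.sup_lt_iff ENNReal.zero_lt_top).2 fun i hi => ?_).ne
    exact ENNReal.rpow_lt_top_of_nonneg (by positivity) enorm_ne_top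
  set r := T.toReal with hr
  have hr0 : 0 ≤ r := ENNReal.toReal_nonneg
  have hTr : T = ENNReal.ofReal r := (ENNReal.ofReal_toReal hTtop).symm
  have hgr : ∀ i ∈ Finset.Icc 1 D, ‖PowerSeries.coeff i g‖ ≤ r ^ i := fun i hi => by
    have hi0 : i ≠ 0 := by rw [Finset.mem_Icc] at hi; omega
    rw [← enorm_rpow_one_div_le_iff _ hi0 hr0, ← hTr, hT]
    exact Finset.le_sup (f := fun i : ℕ => ‖PowerSeries.coeff i g‖ₑ ^ (1 / (i : ℝ))) hi
  have hcoeff : ∀ n, ‖PowerSeries.coeff n (PowerSeries.C b * f)‖ = ‖b‖ * ‖PowerSeries.coeff n f‖ :=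
    fun n => by rw [coeff_C_mul, norm_mul]
  refine le_antisymm ?_ (not_lt.1 fun hlt => ?_)
  · rw [hTr]
    refine CoeffLE.limsup_le (K := ‖b‖) hr0 fun n => ?_
    rw [hcoeff]
    have := hz.coeffLE hf hg hWD hWV hr0 hgr n
    rw [one_mul] at this
    exact mul_le_mul_of_nonneg_left this (norm_nonneg _)
  · have hTpos : 0 < T := pos_of_gt hlt
    have hne : (Finset.Icc 1 D).Nonempty := by
      by_contra hem
      rw [Finset.not_nonempty_iff_eq_empty] at hem
      rw [hT, hem, Finset.sup_empty] at hTpos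
      exact lt_irrefl _ hTpos
    obtain ⟨i, hi, hiT⟩ := Finset.exists_mem_eq_sup (Finset.Icc 1 D) hne
      fun i : ℕ => ‖PowerSeries.coeff i g‖ₑ ^ (1 / (i : ℝ))
    rw [hTr] at hlt
    obtain ⟨s, K, hs, hsr, hK⟩ := exists_coeffLE_of_limsup_lt hlt
    refine hz.not_coeffLE hf hg hWD hWV hs hsr hgr
      ⟨i, hi, norm_eq_pow_of_enorm_rpow_eq (by rw [Finset.mem_Icc] at hi; omega) hr0
        -- Dividing by the nonzero constant `b` turns the bound for `b * f` into one for `f`.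
        (hiT.symm.trans hTr)⟩ (K := ‖b‖⁻¹ * K) fun n => ?_
    have := hK n
    rw [hcoeff] at this
    rwa [mul_assoc, ← div_eq_inv_mul, le_div_iff₀' (norm_pos_iff.2 hb)]

theorem coeff_tildePoly {K E : Type*} [Field K] [Field E] [Algebra K E] (p : ℕ) (ζ : E) (P : K[X])
    {n : ℕ} (hn : n ∈ Finset.Icc 1 P.natDegree) :
    (tildePoly p ζ P).coeff n = C (rootAt p P.natDegree ζ n - 1)⁻¹ *
      ((translatedPoly P).coeff n).map (algebraMap K E) := by
  simp only [tildePoly, finsetSum_coeff, coeff_C_mul_X_pow]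
  rw [Finset.sum_ite_eq, if_pos hn]

theorem coeff_zero_tildePoly {K E : Type*} [Field K] [Field E] [Algebra K E] (p : ℕ) (ζ : E)
    (P : K[X]) : (tildePoly p ζ P).coeff 0 = 0 := by
  simp only [tildePoly, finsetSum_coeff, coeff_C_mul_X_pow]
  refine Finset.sum_eq_zero fun i hi => ?_
  rw [if_neg (by rw [Finset.mem_Icc] at hi; omega)]

theorem map_rootAt {E M : Type*} [Field E] [Field M] (φ : E →+* M) (p D : ℕ) (ζ : E) (n : ℕ) :
    φ (rootAt p D ζ n) = rootAt p D (φ ζ) n := by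
  simp [rootAt]

/-- The comparison of the two exponents, over a common ultrametric extension. -/
theorem limsup_enorm_coeff_eq_sup (p : ℕ) [Fact p.Prime]
    {K Ω E M : Type*} [Field K] [NormedField Ω] [Algebra K Ω] [Field E] [CharZero E] [Algebra K E]
    [NormedField M] [NormedAlgebra ℚ_[p] M] [NormedAlgebra Ω M] [IsUltrametricDist M]
    [Algebra K M] [IsScalarTower K Ω M] [Algebra E M] [IsScalarTower K E M]
    (P : K[X]) (ζ : E) (hζ : IsPrimitiveRoot ζ (p ^ (Nat.log p P.natDegree + 1)))
    (a : Ω) (y : PowerSeries Ω) (hy0 : y ≠ 0) (hy : IsTaylorSolutionAt (derivative P) a y) :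
    Filter.limsup (fun n : ℕ => ‖PowerSeries.coeff n y‖ₑ ^ (1 / (n : ℝ))) Filter.atTop =
      (Finset.Icc 1 P.natDegree).sup fun i : ℕ =>
        ‖aeval (algebraMap Ω M a) (tildeCoeff p ζ P i)‖ₑ ^ (1 / (i : ℝ)) := by
  have : CharZero M := charZero_of_injective_algebraMap (algebraMap ℚ_[p] M).injective
  set D := P.natDegree with hD
  set b := algebraMap Ω M a with hb
  set Q : M[X] := taylor b (P.map (algebraMap K M)) with hQ
  set W : PowerSeries M := PowerSeries.X * PowerSeries.derivative M (Q : PowerSeries M) with hW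
  have hcW : ∀ n, PowerSeries.coeff n W = n * Q.coeff n := fun n => by
    rw [hW, PowerSeries.coeff_X_mul_derivative, Polynomial.coeff_coe]
  set Y := PowerSeries.map (algebraMap Ω M) y with hY
  have hYnorm : ∀ n, ‖PowerSeries.coeff n y‖ₑ = ‖PowerSeries.coeff n Y‖ₑ := fun n => by
    rw [hY, PowerSeries.coeff_map, ← ofReal_norm, ← ofReal_norm, norm_algebraMap']
  have hYW : PowerSeries.X * PowerSeries.derivative M Y = W * Y := by
    have h1 : PowerSeries.X * PowerSeries.derivative Ω y = PowerSeries.X *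
        (taylor a ((derivative P).map (algebraMap K Ω)) : PowerSeries Ω) * y := by
      rw [hy, mul_assoc]
    have h2 := congrArg (PowerSeries.map (algebraMap Ω M)) h1
    have h3 : PowerSeries.map (algebraMap Ω M)
        (taylor a ((derivative P).map (algebraMap K Ω)) : PowerSeries Ω) =
        PowerSeries.derivative M (Q : PowerSeries M) := by
      rw [PowerSeries.derivative_coe, hQ, derivative_taylor, derivative_map,
        ← Polynomial.polynomial_map_coe, map_taylor, Polynomial.map_map,
        ← IsScalarTower.algebraMap_eq]
    rw [map_mul, map_mul, map_mul, h3, PowerSeries.map_X] at h2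
    rw [hW, hY, ← h2]
    congr 1
    ext n
    simp [PowerSeries.coeff_derivative]
  obtain ⟨f, hf⟩ := PowerSeries.exists_isExpOf (W := W) (by
    rw [← PowerSeries.coeff_zero_eq_constantCoeff_apply, hcW]; simp)
  have hYf := hf.eq_C_mul hYW
  -- A solution is its constant term times `f`, so a vanishing constant term would force `y = 0`.
  have hY0 : PowerSeries.constantCoeff Y ≠ 0 := by
    intro h
    rw [h, map_zero, zero_mul] at hYf
    refine hy0 (PowerSeries.ext fun n => ?_)
    have := congrArg (PowerSeries.coeff n) hYf
    rw [hY, PowerSeries.coeff_map, map_zero] at this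
    simpa using this
  have hQt0 : PowerSeries.constantCoeff (tildePoly p ζ P : PowerSeries E[X]) = 0 := by
    rw [← PowerSeries.coeff_zero_eq_constantCoeff_apply, Polynomial.coeff_coe,
      coeff_zero_tildePoly]
  set φ : E[X] →+* M := (aeval b : E[X] →ₐ[E] M).toRingHom with hφ
  have hg := (PowerSeries.IsExpOf.exp_subst hQt0).map φ
  have hφζ : IsPrimitiveRoot (algebraMap E M ζ) (p ^ (Nat.log p D + 1)) :=
    hζ.map_of_injective (algebraMap E M).injective
  have hz := isRootFamily_rootAt p hφζ
  have key := hz.limsup_eq hf hg (fun n hn => ?_) (fun n hn => ?_) hY0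
  · simp only [hYnorm]
    rw [← hYf] at key
    rw [key]
    refine Finset.sup_congr rfl fun i hi => ?_
    rw [tildeCoeff, tildeExp, PowerSeries.coeff_trunc,
      if_pos (Nat.lt_succ_of_le (Finset.mem_Icc.1 hi).2), PowerSeries.coeff_map]
    rfl
  · rw [hcW, coeff_eq_zero_of_natDegree_lt, mul_zero]
    rw [hQ, natDegree_taylor, natDegree_map]
    exact hn
  · have hne : rootAt p D (algebraMap E M ζ) n - 1 ≠ 0 := sub_ne_zero.2 (hz.ne_one n hn)
    have h1 : φ ((tildePoly p ζ P).coeff n) =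
        (rootAt p D (algebraMap E M ζ) n - 1)⁻¹ * Q.coeff n := by
      rw [coeff_tildePoly p ζ P hn, map_mul, hQ, ← aeval_coeff_translatedPoly (E := E), ← map_rootAt]
      simp [hφ, hD]
    rw [hcW, PowerSeries.coeff_map, PowerSeries.coeff_X_mul_derivative, map_mul, map_natCast,
      Polynomial.coeff_coe, h1]
    field_simp

theorem mainTheorem7 (p : ℕ) [Fact p.Prime]
    {K Ω E M : Type*}
    -- an ultrametric extension `K` of `ℚ_p`, and an ultrametric extension `Ω` of `K`
    [NormedField K] [NormedAlgebra ℚ_[p] K] [IsUltrametricDist K]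
    [NormedField Ω] [NormedAlgebra K Ω] [IsUltrametricDist Ω]
    -- a field extension `E` of `K`, in which the root of unity is chosen
    [Field E] [CharZero E] [Algebra K E]
    -- an ultrametric extension `M` of `Ω` that contains `E`
    [NormedField M] [NormedAlgebra Ω M] [IsUltrametricDist M]
    [Algebra K M] [IsScalarTower K Ω M] [Algebra E M] [IsScalarTower K E M]
    -- the equation `y' = L y`, and the primitive `P` of `L` without constant term
    (L P : K[X]) (hP : derivative P = L) (hP0 : P.coeff 0 = 0)
    (ζ : E) (hζ : IsPrimitiveRoot ζ (p ^ (Nat.log p P.natDegree + 1)))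
    (a : Ω) (y : PowerSeries Ω) (hy0 : y ≠ 0) (hy : IsTaylorSolutionAt L a y) :
    -ENNReal.log (convRadius y) =
      (Finset.Icc 1 P.natDegree).sup fun i : ℕ =>
        ((1 / (i : ℝ) : ℝ) : EReal) *
          ENNReal.log ‖aeval (algebraMap Ω M a) (tildeCoeff p ζ P i)‖ₑ := by
  -- The embeddings `ℚ_p → K → Ω → M` are isometric, so their composite makes `M` a normed
  -- `ℚ_p`-algebra.
  let _ : NormedAlgebra ℚ_[p] M :=
    { ((algebraMap Ω M).comp ((algebraMap K Ω).comp (algebraMap ℚ_[p] K))).toAlgebra with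
      norm_smul_le := fun c x => by
        change ‖algebraMap Ω M (algebraMap K Ω (algebraMap ℚ_[p] K c)) * x‖ ≤ _
        rw [norm_mul, norm_algebraMap', norm_algebraMap', norm_algebraMap'] }
  subst hP
  -- The logarithm is an order isomorphism, so it commutes with finite suprema, including the empty
  -- one.
  rw [convRadius, ENNReal.log_inv, neg_neg,
    limsup_enorm_coeff_eq_sup p (E := E) (M := M) P ζ hζ a y hy0 hy, ← ENNReal.logOrderIso_apply,
    map_finset_sup]
  refine Finset.sup_congr rfl fun i _ => ?_
  rw [Function.comp_apply, ENNReal.logOrderIso_apply, ENNReal.log_rpow]
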